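/- All graphs are finite and simple, with at least one node; $\mathrm{v}(G)$ and $\mathrm{e}(G)$ denote the numbers of nodes and edges of $G$. For each $n$ let $G_n$ be a graph and let $d_n\ge 1$ be a real number such that all degrees in $G_n$ are at most $d_n$. For a connected graph $F$ with at least two nodes write $\hom(F,G)$ and $\mathrm{inj}(F,G)$ for the numbers of homomorphisms and injective homomorphisms from $F$ to $G$, and put $$t(F,G,d)=\frac{\hom(F,G)}{\mathrm{v}(G)\,d^{\mathrm{v}(F)-1}},\qquad t_{\mathrm{inj}}(F,G,d)=\frac{\mathrm{inj}(F,G)}{\mathrm{v}(G)\,d\,(d-1)^{\mathrm{v}(F)-2}}.$$ Suppose that $(G_n,d_n)$ has large essential girth, i.e., for every $k\ge 3$ we have $t_{\mathrm{inj}}(C_k,G_n,d_n)\to 0$ as $n\to\infty$, where $C_k$ is the cycle on $k$ nodes. Suppose also that $d_n\to\infty$ and that $$t(K_2,G_n,d_n)=\frac{2\,\mathrm{e}(G_n)}{\mathrm{v}(G_n)\,d_n}\to t(K_2)$$ as $n\to\infty$, for some real number $t(K_2)$. Let $\mathrm{ch}(G,x)$ be the chromatic polynomial of $G$, i.e.,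 the polynomial whose value at each integer $q\ge 0$ is the number of proper $q$-colorings of $G$. Then for every complex number $\xi$ with $|\xi|\ge 8$, $$\frac{|\mathrm{ch}(G_n,\xi d_n)|^{1/\mathrm{v}(G_n)}}{|\xi|\,d_n}\to\exp\left(-t(K_2)\,\mathrm{Re}\,\frac{1}{2\xi}\right)\quad\text{as } n\to\infty.$$ -/

import Mathlib

open Filter Topology

/-- The chromatic polynomial of a finite simple graph, in its expansion over spanning subgraphs:
`∑_{A ⊆ E(G)} (-1)^|A| x^{c(A)}`, with `c(A)` the number of connected components of `(V(G), A)`.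
`chromaticPolynomial_eval` and `eq_chromaticPolynomial` below prove that it is the unique polynomial
whose value at each integer `q ≥ 0` is the number of proper `q`-colorings of `G`. -/
noncomputable def SimpleGraph.chromaticPolynomial {V : Type*} [Fintype V] (G : SimpleGraph V) :
    Polynomial ℤ :=
  open Classical in
  ∑ A ∈ G.edgeFinset.powerset, (-1) ^ A.card *
    Polynomial.X ^ Nat.card (SimpleGraph.fromEdgeSet (A : Set (Sym2 V))).ConnectedComponent

/-- Maps from the vertices that are constant on each edge in `A` correspond to maps from the
connected components of `(V, A)`. -/
theorem SimpleGraph.card_constant_on_edges {V : Type*} [Fintype V] (A : Set (Sym2 V)) (q : ℕ) :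
    Nat.card {f : V → Fin q // ∀ e ∈ A, (e.map f).IsDiag} =
      q ^ Nat.card (SimpleGraph.fromEdgeSet A).ConnectedComponent := by
  classical
  have key : ∀ f : {f : V → Fin q // ∀ e ∈ A, (e.map f).IsDiag}, ∀ v w,
      (SimpleGraph.fromEdgeSet A).Reachable v w → f.1 v = f.1 w := by
    rintro ⟨f, hf⟩ v w ⟨p⟩
    induction p with
    | nil => rfl
    | cons h p ih =>
      rw [SimpleGraph.fromEdgeSet_adj] at h
      have := hf _ h.1
      simp only [Sym2.map_mk, Sym2.mk_isDiag_iff] at this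
      exact this.trans ih
  let E : {f : V → Fin q // ∀ e ∈ A, (e.map f).IsDiag} ≃
      ((SimpleGraph.fromEdgeSet A).ConnectedComponent → Fin q) :=
    { toFun := fun f c => c.lift f.1 (fun v w p _ => key f v w ⟨p⟩)
      invFun := fun g => ⟨fun v => g ((SimpleGraph.fromEdgeSet A).connectedComponentMk v), by
        intro e
        induction e using Sym2.ind with
        | _ v w =>
          intro he
          simp only [Sym2.map_mk, Sym2.mk_isDiag_iff]
          by_cases hvw : v = w
          · rw [hvw]
          · congr 1
            exact SimpleGraph.ConnectedComponent.sound
              (SimpleGraph.Adj.reachable ((SimpleGraph.fromEdgeSet_adj A).2 ⟨he, hvw⟩))⟩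
      left_inv := fun f => rfl
      right_inv := fun g => by
        funext c
        induction c using SimpleGraph.ConnectedComponent.ind with
        | _ v => rfl }
  rw [Nat.card_congr E, Nat.card_fun, Nat.card_fin]

/-- For every integer `q ≥ 0`, the value at `q` is the number of proper `q`-colorings. -/
theorem SimpleGraph.chromaticPolynomial_eval {V : Type*} [Fintype V] (G : SimpleGraph V) (q : ℕ) :
    G.chromaticPolynomial.eval (q : ℤ) = Nat.card (G.Coloring (Fin q)) := by
  classical
  have h1 : ∀ A : Finset (Sym2 V),
      ((q : ℤ) ^ Nat.card (SimpleGraph.fromEdgeSet (A : Set (Sym2 V))).ConnectedComponent) =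
        ∑ f : V → Fin q, ∏ e ∈ A, (if (e.map f).IsDiag then (1 : ℤ) else 0) := by
    intro A
    have := SimpleGraph.card_constant_on_edges (A : Set (Sym2 V)) q
    rw [← Nat.cast_pow, ← this, Nat.card_eq_fintype_card, Fintype.card_subtype,
      Finset.card_filter, Nat.cast_sum]
    refine Finset.sum_congr rfl fun f _ => ?_
    rw [Finset.prod_ite_zero]
    simp
  have h2 : Nat.card (G.Coloring (Fin q)) =
      Nat.card {f : V → Fin q // ∀ e ∈ G.edgeFinset, ¬ (e.map f).IsDiag} := by
    refine Nat.card_congr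
      { toFun := fun C => ⟨C, ?_⟩
        invFun := fun f => SimpleGraph.Coloring.mk f.1 ?_
        left_inv := fun C => rfl
        right_inv := fun f => rfl }
    · intro e
      induction e using Sym2.ind with
      | _ v w =>
        intro he
        simp only [Sym2.map_mk, Sym2.mk_isDiag_iff]
        exact C.valid (by simpa using he)
    · intro v w h
      have := f.2 s(v, w) (by simpa using h)
      simpa only [Sym2.map_mk, Sym2.mk_isDiag_iff] using this
  rw [SimpleGraph.chromaticPolynomial, Polynomial.eval_finsetSum, h2,
    Nat.card_eq_fintype_card, Fintype.card_subtype, Finset.card_filter, Nat.cast_sum]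
  simp only [Polynomial.eval_mul, Polynomial.eval_pow, Polynomial.eval_neg, Polynomial.eval_one,
    Polynomial.eval_X]
  simp_rw [h1, Finset.mul_sum]
  rw [Finset.sum_comm]
  refine Finset.sum_congr rfl fun f _ => ?_
  have h3 : ∏ e ∈ G.edgeFinset, (-(if (e.map f).IsDiag then (1 : ℤ) else 0) + 1) =
      ∑ A ∈ G.edgeFinset.powerset,
        (-1) ^ A.card * ∏ e ∈ A, (if (e.map f).IsDiag then (1 : ℤ) else 0) := by
    rw [Finset.prod_add_one]
    refine Finset.sum_congr rfl fun A _ => ?_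
    rw [Finset.prod_neg]
  rw [← h3]
  have h4 : ∀ e ∈ G.edgeFinset, (-(if (e.map f).IsDiag then (1 : ℤ) else 0) + 1) =
      if ¬ (e.map f).IsDiag then (1 : ℤ) else 0 := by
    intro e _
    split_ifs <;> simp
  rw [Finset.prod_congr rfl h4, Finset.prod_ite_zero]
  simp

/-- The values at nonnegative integers determine the chromatic polynomial. -/
theorem SimpleGraph.eq_chromaticPolynomial {V : Type*} [Fintype V] (G : SimpleGraph V)
    (P : Polynomial ℤ) (hP : ∀ q : ℕ, P.eval (q : ℤ) = Nat.card (G.Coloring (Fin q))) :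
    P = G.chromaticPolynomial := by
  refine Polynomial.eq_of_infinite_eval_eq _ _ ((Set.infinite_range_of_injective
    (Nat.cast_injective (R := ℤ))).mono ?_)
  rintro _ ⟨q, rfl⟩
  exact (hP q).trans (G.chromaticPolynomial_eval q).symm

/-- `(G, d)` is an admissible pair: `d ≥ 1` is a real number and all degrees in `G` are `≤ d`. -/
def SimpleGraph.IsAdmissible {V : Type*} [Fintype V] (G : SimpleGraph V) (d : ℝ) : Prop :=
  1 ≤ d ∧ ∀ v : V, ((G.neighborSet v).ncard : ℝ) ≤ d

/-- The homomorphism density `t(F,G,d) = hom(F,G) / (|V(G)| d^(|V(F)|-1))`, for connected `F`. -/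
noncomputable def SimpleGraph.homDensity {W V : Type*} [Fintype W] [Fintype V]
    (F : SimpleGraph W) (G : SimpleGraph V) (d : ℝ) : ℝ :=
  (Nat.card (F →g G) : ℝ) / (Fintype.card V * d ^ (Fintype.card W - 1))

/-- The injective homomorphism density
`t_inj(F,G,d) = inj(F,G) / (|V(G)| d (d-1)^(|V(F)|-2))`, for connected `F` with at least two
nodes. -/
noncomputable def SimpleGraph.injHomDensity {W V : Type*} [Fintype W] [Fintype V]
    (F : SimpleGraph W) (G : SimpleGraph V) (d : ℝ) : ℝ :=
  (Nat.card {f : F →g G // Function.Injective f} : ℝ) /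
    (Fintype.card V * d * (d - 1) ^ (Fintype.card W - 2))

/-- The sequence `(G_n, d_n)` is admissible and has large essential girth: for each `k ≥ 3`,
`t_inj(C_k, G_n, d_n) → 0`. -/
structure HasLargeEssentialGirth {V : ℕ → Type*} [∀ n, Fintype (V n)]
    (G : ∀ n, SimpleGraph (V n)) (d : ℕ → ℝ) : Prop where
  admissible : ∀ n, (G n).IsAdmissible (d n)
  tendsto_injHomDensity_cycleGraph : ∀ k : ℕ, 3 ≤ k →
    Tendsto (fun n => (SimpleGraph.cycleGraph k).injHomDensity (G n) (d n)) atTop (𝓝 0)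

/-!
Dividing the chromatic polynomial by the contribution of a forest leaves only the effect of cycles,
and large essential girth makes that effect negligible.

Fix `q = ξ d`. For a set `U` of vertices let `P(U)` be the chromatic polynomial of the subgraph
induced on `U`, evaluated at `q`. As functions of `U`, these live in the ring `SetFunction V` of set
functions under subset convolution. There, for a natural number `q`, the function `P` is the `q`-th
power of the indicator `I` of the independent sets (`SimpleGraph.indepFun_pow_apply`). Restriction
to the sets containing a vertex `v` is a derivation of this ring, so with the cluster functions
`κ_v = (D_v I) I⁻¹` one gets `D_v P = q κ_v P`, at first for natural and then for all complex `q`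
(`SimpleGraph.containing_chromaticFun`). Restriction to the sets avoiding `N` is a ring
endomorphism, which gives recursions for the cluster functions. These recursions bound weighted
`ℓ¹` norms by a fixed-point argument (`SimpleGraph.wnorm_avoidFun_le`), and bound the clusters
containing two given vertices by the generating function of self-avoiding walks between them
(`SimpleGraph.wnorm_containing_clusterFun_le`).

The norm bounds give a zero-free region: if `‖q‖ ≥ 8 d`, removing a vertex divides `|P|` by at least
`2 ‖q‖ / 3` (`SimpleGraph.norm_chromaticFun_sdiff_le`). Now build the graph up by adding vertices
and, for each of them, the edges to the earlier vertices one at a time. A vertex multiplies `P` by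
`q`. An edge `uv` multiplies it by `(1 - 1 / q) (1 + η)`, where `η` comes only from clusters at `v`
that meet another neighbour of `u` (`SimpleGraph.attachFun_insert`). Closing up the self-avoiding
walks through `u`, the sum of all `|η|` is at most a constant times `∑ (2 / ‖q‖) ^ j inj(C_{j+1}, G)`
over `j ≥ 2`. After division by the number of vertices this series is dominated by `∑ 4⁻ʲ`, and each
of its terms tends to `0` by the girth hypothesis, so its sum tends to `0`. What remains of
`log |P| / v(G) - log ‖q‖` is `e(G) / v(G) * log |1 - 1 / q|`, and since `d → ∞` this tends to
`-(t / 2) Re (1 / ξ)`.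
-/

/-! ### The ring of set functions -/

/-- Complex-valued functions on the finite subsets of `V`, as a ring under the subset convolution
`(f * g) S = ∑ T ⊆ S, f T * g (S \ T)`. -/
@[ext] structure SetFunction (V : Type*) where
  /-- The underlying function. -/
  toFun : Finset V → ℂ

namespace SetFunction

variable {V : Type*}

instance : CoeFun (SetFunction V) fun _ => Finset V → ℂ := ⟨toFun⟩

@[ext] theorem ext_apply {f g : SetFunction V} (h : ∀ S, f S = g S) : f = g :=
  SetFunction.ext (funext h)

instance : Zero (SetFunction V) := ⟨⟨fun _ => 0⟩⟩

noncomputable instance : Add (SetFunction V) := ⟨fun f g => ⟨fun S => f S + g S⟩⟩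

noncomputable instance : Neg (SetFunction V) := ⟨fun f => ⟨fun S => -f S⟩⟩

noncomputable instance : Sub (SetFunction V) := ⟨fun f g => ⟨fun S => f S - g S⟩⟩

noncomputable instance {R : Type*} [SMul R ℂ] : SMul R (SetFunction V) :=
  ⟨fun q f => ⟨fun S => q • f S⟩⟩

noncomputable instance : AddCommGroup (SetFunction V) :=
  Function.Injective.addCommGroup toFun (fun _ _ => SetFunction.ext) rfl (fun _ _ => rfl)
    (fun _ => rfl) (fun _ _ => rfl) (fun _ _ => rfl) (fun _ _ => rfl)

noncomputable instance : Module ℂ (SetFunction V) :=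
  Function.Injective.module ℂ ⟨⟨toFun, rfl⟩, fun _ _ => rfl⟩ (fun _ _ => SetFunction.ext)
    (fun _ _ => rfl)

@[simp] theorem zero_apply (S : Finset V) : (0 : SetFunction V) S = 0 := rfl

@[simp] theorem add_apply (f g : SetFunction V) (S : Finset V) : (f + g) S = f S + g S := rfl

@[simp] theorem sub_apply (f g : SetFunction V) (S : Finset V) : (f - g) S = f S - g S := rfl

@[simp] theorem smul_apply (q : ℂ) (f : SetFunction V) (S : Finset V) : (q • f) S = q * f S := rfl

/-- The weighted `ℓ¹` norm `∑ S ⊆ U, ‖f S‖ c ^ |S|`. -/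
noncomputable def wnorm (c : ℝ) (U : Finset V) (f : SetFunction V) : ℝ :=
  ∑ S ∈ U.powerset, ‖f S‖ * c ^ S.card

section wnorm

variable {c : ℝ} {U : Finset V}

theorem wnorm_nonneg (hc : 0 ≤ c) (f : SetFunction V) : 0 ≤ wnorm c U f :=
  Finset.sum_nonneg fun _ _ => by positivity

theorem wnorm_le_wnorm (hc : 0 ≤ c) {f g : SetFunction V} (h : ∀ S, ‖f S‖ ≤ ‖g S‖) :
    wnorm c U f ≤ wnorm c U g :=
  Finset.sum_le_sum fun S _ => by gcongr; exact h S

theorem wnorm_mono (hc : 0 ≤ c) {U' : Finset V} (h : U ⊆ U') (f : SetFunction V) :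
    wnorm c U f ≤ wnorm c U' f :=
  Finset.sum_le_sum_of_subset_of_nonneg (Finset.powerset_mono.2 h) fun _ _ _ => by positivity

theorem wnorm_sub_le (hc : 0 ≤ c) (f g : SetFunction V) :
    wnorm c U (f - g) ≤ wnorm c U f + wnorm c U g := by
  simp only [wnorm, ← Finset.sum_add_distrib, ← add_mul]
  exact Finset.sum_le_sum fun S _ => by gcongr; exact norm_sub_le _ _

end wnorm

variable [DecidableEq V]

noncomputable instance : Mul (SetFunction V) :=
  ⟨fun f g => ⟨fun S => ∑ T ∈ S.powerset, f T * g (S \ T)⟩⟩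

instance : One (SetFunction V) := ⟨⟨fun S => if S = ∅ then 1 else 0⟩⟩

theorem mul_apply (f g : SetFunction V) (S : Finset V) :
    (f * g) S = ∑ T ∈ S.powerset, f T * g (S \ T) := rfl

theorem one_apply (S : Finset V) : (1 : SetFunction V) S = if S = ∅ then 1 else 0 := rfl

/-- A chain `T ⊆ S ⊆ U` is the same as a pair of disjoint subsets `T` and `S \ T` of `U`. -/
theorem sum_powerset_powerset {M : Type*} [AddCommMonoid M] (U : Finset V)
    (F : Finset V → Finset V → M) :
    ∑ S ∈ U.powerset, ∑ T ∈ S.powerset, F T (S \ T) =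
      ∑ T ∈ U.powerset, ∑ R ∈ (U \ T).powerset, F T R := by
  rw [Finset.sum_sigma', Finset.sum_sigma']
  refine Finset.sum_bij' (fun x _ => ⟨x.2, x.1 \ x.2⟩) (fun x _ => ⟨x.1 ∪ x.2, x.1⟩) ?_ ?_ ?_ ?_ ?_
  · rintro ⟨S, T⟩ h
    simp only [Finset.mem_sigma, Finset.mem_powerset] at h ⊢
    exact ⟨h.2.trans h.1, Finset.sdiff_subset_sdiff h.1 le_rfl⟩
  · rintro ⟨T, R⟩ h
    simp only [Finset.mem_sigma, Finset.mem_powerset] at h ⊢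
    exact ⟨Finset.union_subset h.1 (h.2.trans Finset.sdiff_subset), Finset.subset_union_left⟩
  · rintro ⟨S, T⟩ h
    simp only [Finset.mem_sigma, Finset.mem_powerset] at h
    simp [Finset.union_sdiff_of_subset h.2]
  · rintro ⟨T, R⟩ h
    simp only [Finset.mem_sigma, Finset.mem_powerset] at h
    have : Disjoint T R := (Finset.disjoint_sdiff (s := T) (t := U)).mono_right h.2
    simp [Finset.union_sdiff_cancel_left this]
  · rintro ⟨S, T⟩ h
    rfl

protected theorem mul_comm (f g : SetFunction V) : f * g = g * f := by
  ext S
  rw [mul_apply, mul_apply]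
  refine Finset.sum_bij' (fun T _ => S \ T) (fun T _ => S \ T) ?_ ?_ ?_ ?_ ?_
  · intro T _; simp
  · intro T _; simp
  · intro T hT
    exact Finset.sdiff_sdiff_eq_self (Finset.mem_powerset.1 hT)
  · intro T hT
    exact Finset.sdiff_sdiff_eq_self (Finset.mem_powerset.1 hT)
  · intro T hT
    rw [Finset.sdiff_sdiff_eq_self (Finset.mem_powerset.1 hT), mul_comm]

protected theorem mul_assoc (f g h : SetFunction V) : f * g * h = f * (g * h) := by
  ext U
  simp only [mul_apply, Finset.sum_mul, Finset.mul_sum]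
  rw [← sum_powerset_powerset U (fun T R => f T * (g R * h ((U \ T) \ R)))]
  refine Finset.sum_congr rfl fun S hS => Finset.sum_congr rfl fun T hT => ?_
  rw [sdiff_sdiff_left, Finset.sup_eq_union, Finset.union_sdiff_of_subset (Finset.mem_powerset.1 hT),
    mul_assoc]

protected theorem one_mul (f : SetFunction V) : 1 * f = f := by
  ext S
  rw [mul_apply, Finset.sum_eq_single ∅]
  · simp [one_apply]
  · intro T _ hT
    simp [one_apply, hT]
  · simp

protected theorem left_distrib (f g h : SetFunction V) : f * (g + h) = f * g + f * h := by
  ext S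
  simp [mul_apply, mul_add, Finset.sum_add_distrib]

noncomputable instance : CommRing (SetFunction V) where
  __ := (inferInstance : AddCommGroup (SetFunction V))
  mul_assoc := SetFunction.mul_assoc
  mul_comm := SetFunction.mul_comm
  one_mul := SetFunction.one_mul
  mul_one f := by rw [SetFunction.mul_comm, SetFunction.one_mul]
  left_distrib := SetFunction.left_distrib
  right_distrib f g h := by
    rw [SetFunction.mul_comm, SetFunction.left_distrib, SetFunction.mul_comm h,
      SetFunction.mul_comm h]
  zero_mul f := by ext S; simp [mul_apply]
  mul_zero f := by ext S; simp [mul_apply]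

noncomputable instance : Algebra ℂ (SetFunction V) := Algebra.ofModule
  (fun q f g => by ext S; simp [mul_apply, Finset.mul_sum, mul_assoc])
  (fun q f g => by ext S; simp [mul_apply, Finset.mul_sum, mul_left_comm])

theorem mul_apply_empty (f g : SetFunction V) : (f * g) ∅ = f ∅ * g ∅ := by simp [mul_apply]

theorem pow_apply_eq_zero {f : SetFunction V} (hf : f ∅ = 0) (k : ℕ) :
    ∀ S : Finset V, S.card < k → (f ^ k) S = 0 := by
  induction k with
  | zero => intro S hS; omega
  | succ k ih =>
    intro S hS
    rw [pow_succ', mul_apply]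
    refine Finset.sum_eq_zero fun T hT => ?_
    rcases T.eq_empty_or_nonempty with rfl | hne
    · rw [hf, zero_mul]
    · have h1 := Finset.card_sdiff_add_card_eq_card (Finset.mem_powerset.1 hT)
      have h2 := hne.card_pos
      rw [ih _ (by omega), mul_zero]

theorem isUnit_of_apply_empty [Fintype V] {f : SetFunction V} (hf : f ∅ = 1) : IsUnit f := by
  have h : IsNilpotent (f - 1) := by
    refine ⟨Fintype.card V + 1, ?_⟩
    ext S
    exact pow_apply_eq_zero (by simp [hf, one_apply]) _ _ (Nat.lt_succ_of_le S.card_le_univ)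
  simpa using h.isUnit_one_add

/-- The part of `f` on the sets that contain `v`; a derivation of the convolution ring. -/
def containing (v : V) (f : SetFunction V) : SetFunction V :=
  ⟨fun S => if v ∈ S then f S else 0⟩

theorem containing_apply (v : V) (f : SetFunction V) (S : Finset V) :
    containing v f S = if v ∈ S then f S else 0 := rfl

theorem containing_mul (v : V) (f g : SetFunction V) :
    containing v (f * g) = containing v f * g + f * containing v g := by
  ext S
  simp only [containing_apply, mul_apply, add_apply, ← Finset.sum_add_distrib]
  split_ifs with h
  · refine Finset.sum_congr rfl fun T _ => ?_
    by_cases hT : v ∈ T <;> simp [hT, h]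
  · refine (Finset.sum_eq_zero fun T hT => ?_).symm
    have : v ∉ T := fun hv => h (Finset.mem_powerset.1 hT hv)
    simp [this, h]

theorem containing_sub (v : V) (f g : SetFunction V) :
    containing v (f - g) = containing v f - containing v g := by
  ext S
  simp only [containing_apply, sub_apply]
  split_ifs <;> simp

theorem containing_one (v : V) : containing v (1 : SetFunction V) = 0 := by
  ext S
  simp only [containing_apply, one_apply, zero_apply]
  split_ifs with h1 h2 <;> simp_all

/-- The part of `f` on the sets that avoid `N`; a ring endomorphism. -/
def avoiding (N : Finset V) (f : SetFunction V) : SetFunction V :=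
  ⟨fun S => if Disjoint S N then f S else 0⟩

theorem avoiding_apply (N : Finset V) (f : SetFunction V) (S : Finset V) :
    avoiding N f S = if Disjoint S N then f S else 0 := rfl

theorem avoiding_mul (N : Finset V) (f g : SetFunction V) :
    avoiding N (f * g) = avoiding N f * avoiding N g := by
  ext S
  simp only [avoiding_apply, mul_apply]
  split_ifs with h
  · refine Finset.sum_congr rfl fun T hT => ?_
    rw [if_pos (h.mono_left (Finset.mem_powerset.1 hT)), if_pos (h.mono_left Finset.sdiff_subset)]
  · refine (Finset.sum_eq_zero fun T hT => ?_).symm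
    by_cases h1 : Disjoint T N
    · have h2 : ¬ Disjoint (S \ T) N := fun h2 => h <| by
        rw [← Finset.union_sdiff_of_subset (Finset.mem_powerset.1 hT)]
        exact Finset.disjoint_union_left.2 ⟨h1, h2⟩
      simp [h2]
    · simp [h1]

theorem avoiding_empty (f : SetFunction V) : avoiding ∅ f = f := by
  ext S; simp [avoiding_apply]

theorem containing_avoiding (v : V) (N : Finset V) (f : SetFunction V) :
    containing v (avoiding N f) = avoiding N (containing v f) := by
  ext S
  simp only [avoiding_apply, containing_apply]
  split_ifs <;> rfl

theorem avoiding_insert (v : V) (N : Finset V) (f : SetFunction V) :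
    avoiding (insert v N) f = avoiding N f - containing v (avoiding N f) := by
  ext S
  simp only [avoiding_apply, containing_apply, sub_apply, Finset.disjoint_insert_right]
  by_cases h : v ∈ S <;> simp [h]

/-- If `f` lives on the sets containing `v`, then removing `v` from the first factor computes
`f * g`. -/
theorem containing_mul_apply_insert {v : V} {S : Finset V} (hv : v ∉ S) (f g : SetFunction V) :
    (containing v f * g) (insert v S) = ∑ T ∈ S.powerset, f (insert v T) * g (S \ T) := by
  rw [mul_apply, Finset.sum_powerset_insert hv]
  rw [Finset.sum_eq_zero, zero_add]
  · refine Finset.sum_congr rfl fun T hT => ?_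
    rw [containing_apply, if_pos (Finset.mem_insert_self _ _), Finset.insert_sdiff_insert,
      Finset.sdiff_insert_of_notMem hv]
  · intro T hT
    rw [containing_apply, if_neg fun h => hv (Finset.mem_powerset.1 hT h), zero_mul]

section wnorm

variable {c : ℝ} {U : Finset V}

theorem wnorm_mul_le (hc : 0 ≤ c) (f g : SetFunction V) :
    wnorm c U (f * g) ≤ wnorm c U f * wnorm c U g := by
  calc wnorm c U (f * g)
      ≤ ∑ S ∈ U.powerset, ∑ T ∈ S.powerset,
          (‖f T‖ * c ^ T.card) * (‖g (S \ T)‖ * c ^ (S \ T).card) := by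
        refine Finset.sum_le_sum fun S _ => ?_
        rw [mul_apply]
        refine (mul_le_mul_of_nonneg_right (norm_sum_le _ _) (by positivity)).trans_eq ?_
        rw [Finset.sum_mul]
        refine Finset.sum_congr rfl fun T hT => ?_
        rw [← Finset.card_sdiff_add_card_eq_card (Finset.mem_powerset.1 hT), pow_add, norm_mul]
        ring
    _ = ∑ T ∈ U.powerset, ∑ R ∈ (U \ T).powerset,
          (‖f T‖ * c ^ T.card) * (‖g R‖ * c ^ R.card) :=
        sum_powerset_powerset U fun T R => (‖f T‖ * c ^ T.card) * (‖g R‖ * c ^ R.card)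
    _ ≤ ∑ T ∈ U.powerset, (‖f T‖ * c ^ T.card) * wnorm c U g := by
        refine Finset.sum_le_sum fun T _ => ?_
        rw [← Finset.mul_sum]
        exact mul_le_mul_of_nonneg_left (wnorm_mono hc Finset.sdiff_subset g) (by positivity)
    _ = _ := by rw [← Finset.sum_mul]; rfl

theorem wnorm_avoiding_le (hc : 0 ≤ c) (N : Finset V) (f : SetFunction V) :
    wnorm c U (avoiding N f) ≤ wnorm c U f :=
  wnorm_le_wnorm hc fun S => by rw [avoiding_apply]; split_ifs <;> simp

theorem wnorm_containing_le (hc : 0 ≤ c) (v : V) (f : SetFunction V) :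
    wnorm c U (containing v f) ≤ wnorm c U f :=
  wnorm_le_wnorm hc fun S => by rw [containing_apply]; split_ifs <;> simp

theorem wnorm_one : wnorm c U 1 = 1 := by
  rw [wnorm, Finset.sum_eq_single ∅]
  · simp [one_apply]
  · intro T _ hT
    simp [one_apply, hT]
  · simp

theorem wnorm_containing_eq_zero {v : V} (hv : v ∉ U) (f : SetFunction V) :
    wnorm c U (containing v f) = 0 :=
  Finset.sum_eq_zero fun S hS => by
    rw [containing_apply, if_neg fun h => hv (Finset.mem_powerset.1 hS h)]; simp

theorem wnorm_containing {v : V} (hv : v ∈ U) {f g : SetFunction V}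
    (h : ∀ S, v ∉ S → f (insert v S) = g S) :
    wnorm c U (containing v f) = c * wnorm c (U.erase v) g := by
  have hv' : v ∉ U.erase v := Finset.notMem_erase v U
  rw [wnorm, ← Finset.insert_erase hv, Finset.sum_powerset_insert hv', Finset.sum_eq_zero, zero_add,
    wnorm, Finset.erase_insert hv', Finset.mul_sum]
  · refine Finset.sum_congr rfl fun S hS => ?_
    have hvS : v ∉ S := fun h => hv' (Finset.mem_powerset.1 hS h)
    rw [containing_apply, if_pos (Finset.mem_insert_self _ _), h S hvS,
      Finset.card_insert_of_notMem hvS, pow_succ]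
    ring
  · intro S hS
    rw [containing_apply, if_neg fun h => hv' (Finset.mem_powerset.1 hS h)]; simp

end wnorm

end SetFunction

/-! ### Clusters of a graph -/

namespace SetFunction

variable {V : Type*} [DecidableEq V]

theorem containing_mul_containing (v : V) (f g : SetFunction V) :
    containing v f * containing v g = 0 := by
  ext S
  rw [mul_apply, zero_apply]
  refine Finset.sum_eq_zero fun T _ => ?_
  by_cases h : v ∈ T <;> simp [containing_apply, h]

theorem containing_containing (v : V) (f : SetFunction V) :
    containing v (containing v f) = containing v f := by
  ext S
  simp only [containing_apply]
  split_ifs <;> rfl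

end SetFunction

namespace SimpleGraph

open SetFunction

variable {V : Type*} (G : SimpleGraph V)

/-- The values at `q` of the chromatic polynomials of the induced subgraphs. -/
noncomputable def chromaticFun (q : ℂ) : SetFunction V :=
  ⟨fun S => Polynomial.aeval q (G.induce (S : Set V)).chromaticPolynomial⟩

theorem chromaticFun_apply (q : ℂ) (S : Finset V) :
    G.chromaticFun q S = Polynomial.aeval q (G.induce (S : Set V)).chromaticPolynomial := rfl

open Classical in
/-- The indicator function of the independent sets of `G`. Its `q`-th convolution power counts
proper `q`-colorings. -/
noncomputable def indepFun : SetFunction V := ⟨fun S => if G.IsIndepSet (S : Set V) then 1 else 0⟩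

open Classical in
theorem indepFun_apply (S : Finset V) :
    G.indepFun S = if G.IsIndepSet (S : Set V) then 1 else 0 := rfl

theorem indepFun_empty : G.indepFun ∅ = 1 := by
  simp [indepFun_apply, IsIndepSet]

theorem chromaticFun_univ [Fintype V] (q : ℂ) :
    G.chromaticFun q Finset.univ = Polynomial.aeval q G.chromaticPolynomial := by
  have h : (G.induce ((Finset.univ : Finset V) : Set V)).chromaticPolynomial =
      G.chromaticPolynomial := by
    refine eq_chromaticPolynomial _ _ fun q => ?_
    rw [chromaticPolynomial_eval]
    congr 1
    rw [Finset.coe_univ]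
    exact Nat.card_congr
      { toFun := fun C => C.comp (induceUnivIso G).symm.toHom
        invFun := fun C => C.comp (induceUnivIso G).toHom
        left_inv := fun C => by ext; rfl
        right_inv := fun C => by ext; rfl }
  rw [chromaticFun_apply, h]

variable [DecidableEq V]

/-- The convolution inverse of the indicator of the independent sets, which is a unit because it is
`1` at `∅`. -/
noncomputable def indepInv : SetFunction V := Ring.inverse G.indepFun

/-- The cluster function rooted at `v`: the part of `log G.indepFun` on the sets containing `v`,
written as a logarithmic derivative so that no logarithm has to be formed. -/
noncomputable def clusterFun (v : V) : SetFunction V := containing v G.indepFun * G.indepInv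

/-- The quotient, in the convolution ring, of the indicator of the independent sets avoiding `N` by
the indicator of all independent sets. -/
noncomputable def avoidFun (N : Finset V) : SetFunction V := avoiding N G.indepFun * G.indepInv

theorem containing_clusterFun (v : V) : containing v (G.clusterFun v) = G.clusterFun v := by
  rw [clusterFun, containing_mul, containing_containing, containing_mul_containing, add_zero]

theorem wnorm_clusterFun_of_notMem {c : ℝ} {U : Finset V} {v : V} (hv : v ∉ U) :
    wnorm c U (G.clusterFun v) = 0 := by
  rw [← containing_clusterFun, wnorm_containing_eq_zero hv]

variable [Fintype V]

theorem indepFun_mul_indepInv : G.indepFun * G.indepInv = 1 :=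
  Ring.mul_inverse_cancel _ (isUnit_of_apply_empty G.indepFun_empty)

theorem clusterFun_mul_indepFun (v : V) :
    G.clusterFun v * G.indepFun = containing v G.indepFun := by
  rw [clusterFun]
  linear_combination (containing v G.indepFun) * G.indepFun_mul_indepInv

theorem avoidFun_empty : G.avoidFun ∅ = 1 := by
  rw [avoidFun, avoiding_empty, indepFun_mul_indepInv]

theorem avoidFun_apply_empty (N : Finset V) : G.avoidFun N ∅ = 1 := by
  have h := congrArg (fun f : SetFunction V => f ∅) G.indepFun_mul_indepInv
  simp only [mul_apply_empty, indepFun_empty, one_mul, one_apply, if_true] at h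
  simp [avoidFun, mul_apply_empty, avoiding_apply, indepFun_empty, h]

theorem avoidFun_insert (v : V) (N : Finset V) :
    G.avoidFun (insert v N) = G.avoidFun N - avoiding N (G.clusterFun v) * G.avoidFun N := by
  have h : avoiding N (G.clusterFun v) * avoiding N G.indepFun =
      containing v (avoiding N G.indepFun) := by
    rw [← avoiding_mul, clusterFun_mul_indepFun, containing_avoiding]
  simp only [avoidFun, avoiding_insert]
  linear_combination G.indepInv * h

theorem containing_avoidFun (v : V) (N : Finset V) :
    containing v (G.avoidFun N) =
      avoiding N (G.clusterFun v) * G.avoidFun N - G.clusterFun v * G.avoidFun N := by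
  have h : avoiding N (G.clusterFun v) * avoiding N G.indepFun =
      containing v (avoiding N G.indepFun) := by
    rw [← avoiding_mul, clusterFun_mul_indepFun, containing_avoiding]
  have h1 := G.indepFun_mul_indepInv
  have h2 := congrArg (containing v) h1
  rw [containing_mul, containing_one] at h2
  simp only [avoidFun, containing_mul, clusterFun] at h ⊢
  linear_combination (avoiding N G.indepFun * G.indepInv) * h2 - G.indepInv * h -
    (avoiding N G.indepFun * containing v G.indepInv) * h1

/-- Deleting the root of a cluster leaves a function of the neighbourhood of the root only. -/
theorem clusterFun_apply_insert [DecidableRel G.Adj] {v : V} {S : Finset V} (hv : v ∉ S) :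
    G.clusterFun v (insert v S) = G.avoidFun (G.neighborFinset v) S := by
  rw [clusterFun, containing_mul_apply_insert hv, avoidFun, mul_apply]
  refine Finset.sum_congr rfl fun T hT => ?_
  have hvT : v ∉ T := fun h => hv (Finset.mem_powerset.1 hT h)
  congr 1
  rw [avoiding_apply, indepFun_apply, indepFun_apply, ← ite_and]
  congr 1
  have : Std.Symm fun a b => ¬ G.Adj a b := ⟨fun a b h h' => h h'.symm⟩
  rw [Finset.coe_insert, IsIndepSet, Set.pairwise_insert_of_symm_of_notMem (by simpa using hvT),
    and_comm]
  simp only [Finset.disjoint_left, mem_neighborFinset, Finset.mem_coe]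

/-! ### Colorings and the chromatic polynomials of induced subgraphs -/

/-- Partial proper colorings of `G` with domain `S` and colors `1, …, q`; the value `0` stands for
an uncolored vertex. -/
abbrev PartialColoring (q : ℕ) (S : Finset V) : Type _ :=
  {f : V → ℕ // (∀ v, (v ∈ S → 1 ≤ f v ∧ f v ≤ q) ∧ (v ∉ S → f v = 0)) ∧
    ∀ u ∈ S, ∀ v ∈ S, G.Adj u v → f u ≠ f v}

/-- Partial colorings with domain `S` are the colorings of the subgraph induced on `S`. -/
noncomputable def partialColoringEquiv (q : ℕ) (S : Finset V) :
    G.PartialColoring q S ≃ (G.induce (S : Set V)).Coloring (Fin q) where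
  toFun f := Coloring.mk (fun v => ⟨f.1 v - 1, by
      have := (f.2.1 v).1 v.2
      omega⟩) (by
    intro u v h h'
    have hu := (f.2.1 u).1 u.2
    have hv := (f.2.1 v).1 v.2
    refine f.2.2 u u.2 v v.2 h ?_
    simp only [Fin.mk.injEq] at h'
    omega)
  invFun C := ⟨fun v => if h : v ∈ S then (C ⟨v, h⟩ : ℕ) + 1 else 0, by
    refine ⟨fun v => ⟨fun h => ?_, fun h => ?_⟩, fun u hu v hv h => ?_⟩
    · have := (C ⟨v, h⟩).2
      simp only [h, dif_pos]
      omega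
    · simp [h]
    · have : C ⟨u, hu⟩ ≠ C ⟨v, hv⟩ := C.valid h
      simpa [hu, hv, Fin.ext_iff] using this⟩
  left_inv f := by
    refine Subtype.ext (funext fun v => ?_)
    by_cases h : v ∈ S
    · have := (f.2.1 v).1 h
      simp only [h, dif_pos]
      change f.1 v - 1 + 1 = f.1 v
      omega
    · have := (f.2.1 v).2 h
      simp [h, this]
  right_inv C := by
    ext v
    have hv : (v : V) ∈ S := v.2
    change (if h : (v : V) ∈ S then (C ⟨v, h⟩ : ℕ) + 1 else 0) - 1 = _
    simp [hv]

/-- A coloring with `q + 1` colors is an independent color class for the last color together with a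
coloring of the remaining vertices with `q` colors. -/
noncomputable def partialColoringSuccEquiv (q : ℕ) (S : Finset V) :
    G.PartialColoring (q + 1) S ≃
      Σ T : {T : Finset V // T ∈ S.powerset ∧ G.IsIndepSet (T : Set V)},
        G.PartialColoring q (S \ T.1) where
  toFun f := ⟨⟨S.filter (fun v => f.1 v = q + 1), by
      refine ⟨by simp, fun u hu v hv _ h => ?_⟩
      simp only [Finset.coe_filter, Set.mem_ofPred_eq] at hu hv
      exact f.2.2 u hu.1 v hv.1 h (hu.2.trans hv.2.symm)⟩,
    ⟨fun v => if f.1 v = q + 1 then 0 else f.1 v, by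
      refine ⟨fun v => ⟨fun h => ?_, fun h => ?_⟩, fun u hu v hv h => ?_⟩
      · simp only [Finset.mem_sdiff, Finset.mem_filter, not_and] at h
        have h1 := (f.2.1 v).1 h.1
        have h2 := h.2 h.1
        simp only [h2, if_false]
        omega
      · simp only [Finset.mem_sdiff, Finset.mem_filter, not_and] at h
        by_cases hv : v ∈ S
        · have : f.1 v = q + 1 := by simpa [hv] using h
          simp [this]
        · simp [(f.2.1 v).2 hv]
      · simp only [Finset.mem_sdiff, Finset.mem_filter, not_and] at hu hv
        simp only [hu.2 hu.1, hv.2 hv.1, if_false]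
        exact f.2.2 u hu.1 v hv.1 h⟩⟩
  invFun x := ⟨fun v => if v ∈ x.1.1 then q + 1 else x.2.1 v, by
    obtain ⟨⟨T, hT, hI⟩, g, hg1, hg2⟩ := x
    have hT' := Finset.mem_powerset.1 hT
    refine ⟨fun v => ⟨fun h => ?_, fun h => ?_⟩, fun u hu v hv h => ?_⟩
    · by_cases hv : v ∈ T
      · simp [hv]
      · have := (hg1 v).1 (by simp [h, hv])
        simp only [hv, if_false]
        omega
    · have hv : v ∉ T := fun hv => h (hT' hv)
      simpa [hv] using (hg1 v).2 (by simp [h])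
    · by_cases hu' : u ∈ T <;> by_cases hv' : v ∈ T <;> simp only [hu', hv', if_true, if_false]
      · exact absurd h (hI hu' hv' h.ne)
      · have := (hg1 v).1 (by simp [hv, hv'])
        omega
      · have := (hg1 u).1 (by simp [hu, hu'])
        omega
      · exact hg2 u (by simp [hu, hu']) v (by simp [hv, hv']) h⟩
  left_inv f := by
    refine Subtype.ext (funext fun v => ?_)
    by_cases hv : v ∈ S
    · by_cases h : f.1 v = q + 1 <;> simp [hv, h]
    · simp [hv, (f.2.1 v).2 hv]
  right_inv x := by
    obtain ⟨⟨T, hT, hI⟩, g, hg1, hg2⟩ := x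
    have hT' := Finset.mem_powerset.1 hT
    have key : ∀ v, v ∉ T → g v ≠ q + 1 := by
      intro v hv h
      by_cases hS : v ∈ S
      · have := (hg1 v).1 (by simp [hS, hv])
        omega
      · have := (hg1 v).2 (by simp [hS])
        omega
    have hTe : S.filter (fun v => (if v ∈ T then q + 1 else g v) = q + 1) = T := by
      ext v
      by_cases hv : v ∈ T
      · simp [hv, hT' hv]
      · simp [hv, key v hv]
    have hge : (fun v => if (if v ∈ T then q + 1 else g v) = q + 1 then 0 else
        (if v ∈ T then q + 1 else g v)) = g := by
      funext v
      by_cases hv : v ∈ T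
      · have := (hg1 v).2 (by simp [hv])
        simp [hv, this]
      · simp [hv, key v hv]
    refine Sigma.ext (Subtype.ext hTe) ?_
    refine (Subtype.heq_iff_coe_eq ?_).2 hge
    intro f
    simp only [hTe]

instance finite_partialColoring (q : ℕ) (S : Finset V) : Finite (G.PartialColoring q S) :=
  Finite.of_equiv _ (G.partialColoringEquiv q S).symm

theorem indepFun_pow_apply (q : ℕ) : ∀ S : Finset V,
    (G.indepFun ^ q) S = Nat.card (G.PartialColoring q S) := by
  classical
  induction q with
  | zero =>
    intro S
    rw [pow_zero, one_apply, Nat.card_congr (G.partialColoringEquiv 0 S)]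
    split_ifs with h
    · subst h
      have : Unique ((G.induce ((∅ : Finset V) : Set V)).Coloring (Fin 0)) :=
        { default := Coloring.mk (fun v => absurd v.2 (by simp)) (fun {v} => absurd v.2 (by simp))
          uniq := fun C => by ext v; exact absurd v.2 (by simp) }
      simp
    · obtain ⟨v, hv⟩ := Finset.nonempty_iff_ne_empty.2 h
      have : IsEmpty ((G.induce (S : Set V)).Coloring (Fin 0)) := ⟨fun C => (C ⟨v, hv⟩).elim0⟩
      simp
  | succ q ih =>
    intro S
    rw [pow_succ', mul_apply, Nat.card_congr (G.partialColoringSuccEquiv q S), Nat.card_sigma]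
    push_cast
    simp_rw [← ih]
    rw [← Finset.sum_subtype (S.powerset.filter fun T : Finset V => G.IsIndepSet (T : Set V))
      (by simp)
      (fun T => (G.indepFun ^ q) (S \ T)), Finset.sum_filter]
    refine Finset.sum_congr rfl fun T _ => ?_
    rw [indepFun_apply]
    split_ifs <;> simp

theorem chromaticFun_natCast (q : ℕ) : G.chromaticFun q = G.indepFun ^ q := by
  ext S
  rw [indepFun_pow_apply, Nat.card_congr (G.partialColoringEquiv q S), chromaticFun_apply]
  have := (G.induce (S : Set V)).chromaticPolynomial_eval q
  rw [← Int.cast_natCast (R := ℂ) (Nat.card _), ← this, ← Int.cast_natCast (R := ℂ) q,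
    ← eq_intCast (algebraMap ℤ ℂ) q, Polynomial.aeval_algebraMap_apply]
  simp

theorem chromaticFun_empty (q : ℂ) : G.chromaticFun q ∅ = 1 := by
  have h : (1 : Polynomial ℤ) = (G.induce ((∅ : Finset V) : Set V)).chromaticPolynomial := by
    refine eq_chromaticPolynomial _ _ fun q => ?_
    have := G.indepFun_pow_apply q ∅
    rw [Nat.card_congr (G.partialColoringEquiv q ∅)] at this
    have h2 : (G.indepFun ^ q) ∅ = 1 := by
      clear this
      induction q with
      | zero => simp [one_apply]
      | succ q ih => rw [pow_succ, mul_apply_empty, ih, indepFun_empty, one_mul]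
    rw [h2] at this
    rw [Polynomial.eval_one]
    exact_mod_cast this
  rw [chromaticFun_apply, ← h, map_one]

/-- The rooted cluster expansion: at a natural number `q` it is the product rule applied to
`G.indepFun ^ q`, and in each set both sides are polynomials in `q`. -/
theorem containing_chromaticFun (v : V) (q : ℂ) :
    containing v (G.chromaticFun q) = q • (G.clusterFun v * G.chromaticFun q) := by
  have hnat : ∀ q : ℕ, containing v (G.chromaticFun q) =
      (q : ℂ) • (G.clusterFun v * G.chromaticFun q) := by
    intro q
    rw [chromaticFun_natCast, Nat.cast_smul_eq_nsmul, nsmul_eq_mul]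
    induction q with
    | zero => simp [containing_one]
    | succ q ih =>
      rw [pow_succ, containing_mul, ih, ← clusterFun_mul_indepFun]
      push_cast
      ring
  ext S
  by_cases hS : v ∈ S
  · let p : Finset V → Polynomial ℂ := fun T =>
      (G.induce (T : Set V)).chromaticPolynomial.map (algebraMap ℤ ℂ)
    have hp : ∀ (q : ℂ) T, (p T).eval q = G.chromaticFun q T := fun q T => by
      rw [Polynomial.eval_map_algebraMap, chromaticFun_apply]
    have key : p S = Polynomial.X * ∑ T ∈ S.powerset,
        Polynomial.C (G.clusterFun v T) * p (S \ T) := by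
      refine Polynomial.eq_of_infinite_eval_eq _ _ ((Set.infinite_range_of_injective
        (Nat.cast_injective (R := ℂ))).mono ?_)
      rintro _ ⟨q, rfl⟩
      have := congrArg (fun f : SetFunction V => f S) (hnat q)
      simp only [containing_apply, if_pos hS, smul_apply, mul_apply] at this
      simpa [Polynomial.eval_finsetSum, hp] using this
    have := congrArg (Polynomial.eval q) key
    simpa [Polynomial.eval_finsetSum, hp, containing_apply, hS, mul_apply] using this
  · rw [containing_apply, if_neg hS, smul_apply, mul_apply, Finset.sum_eq_zero, mul_zero]
    intro T hT
    rw [← containing_clusterFun, containing_apply,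
      if_neg fun h => hS (Finset.mem_powerset.1 hT h), zero_mul]

end SimpleGraph

/-! ### Norms of the cluster functions -/

namespace SimpleGraph

open SetFunction

variable {V : Type*} [Fintype V] [DecidableEq V] (G : SimpleGraph V)

section norms

variable {c α β d : ℝ} {U : Finset V}

theorem wnorm_clusterFun [DecidableRel G.Adj] {v : V} (hv : v ∈ U) :
    wnorm c U (G.clusterFun v) = c * wnorm c (U.erase v) (G.avoidFun (G.neighborFinset v)) := by
  rw [← containing_clusterFun]
  exact wnorm_containing hv fun S hS => G.clusterFun_apply_insert hS

/-- `G.avoidFun N` is a product of `|N|` factors `1 - avoiding N' (G.clusterFun v)`. -/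
theorem wnorm_avoidFun_le_pow (hc : 0 ≤ c) (hβ : 0 ≤ β)
    (h : ∀ v, wnorm c U (G.clusterFun v) ≤ β) (N : Finset V) :
    wnorm c U (G.avoidFun N) ≤ (1 + β) ^ N.card := by
  induction N using Finset.induction_on with
  | empty => simp [avoidFun_empty, wnorm_one]
  | insert v N hv ih =>
    rw [avoidFun_insert, Finset.card_insert_of_notMem hv, pow_succ']
    have h1 := wnorm_sub_le (U := U) hc (G.avoidFun N) (avoiding N (G.clusterFun v) * G.avoidFun N)
    have h2 := wnorm_mul_le (U := U) hc (avoiding N (G.clusterFun v)) (G.avoidFun N)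
    have h3 := (wnorm_avoiding_le (U := U) hc N (G.clusterFun v)).trans (h v)
    have h4 := mul_le_mul_of_nonneg_right h3 (wnorm_nonneg (U := U) hc (G.avoidFun N))
    have h5 := mul_le_mul_of_nonneg_left ih (by linarith : 0 ≤ 1 + β)
    linarith

theorem one_add_pow_le_of_exp_le (hc : 0 ≤ c) (hα : 0 ≤ α) (hd : Real.exp (c * α * d) ≤ α)
    {n : ℕ} (hn : (n : ℝ) ≤ d) : (1 + c * α) ^ n ≤ α := by
  have h0 : 0 ≤ c * α := mul_nonneg hc hα
  calc (1 + c * α) ^ n ≤ Real.exp (c * α) ^ n := by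
        gcongr
        linarith [Real.add_one_le_exp (c * α)]
    _ = Real.exp (c * α * n) := by rw [← Real.exp_nat_mul]; ring_nf
    _ ≤ Real.exp (c * α * d) := by gcongr
    _ ≤ α := hd

theorem wnorm_containing_avoidFun_le (hc : 0 ≤ c) (hβ : 0 ≤ β)
    (h : ∀ v, wnorm c U (G.clusterFun v) ≤ β) (w : V) (N : Finset V) :
    wnorm c U (containing w (G.avoidFun N)) ≤
      (1 + β) ^ N.card * ∑ v ∈ N, wnorm c U (containing w (G.clusterFun v)) := by
  induction N using Finset.induction_on with
  | empty => simp [avoidFun_empty, containing_one, wnorm]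
  | insert v N hv ih =>
    rw [avoidFun_insert, Finset.card_insert_of_notMem hv, Finset.sum_insert hv, containing_sub,
      containing_mul, containing_avoiding, ← sub_sub, pow_succ']
    have hA := G.wnorm_avoidFun_le_pow hc hβ h N
    have hA0 := wnorm_nonneg (U := U) hc (G.avoidFun N)
    have hD0 := wnorm_nonneg (U := U) hc (containing w (G.avoidFun N))
    have hB0 := wnorm_nonneg (U := U) hc (containing w (G.clusterFun v))
    have hp0 : 0 ≤ (1 + β) ^ N.card := by positivity
    have h1 := wnorm_sub_le (U := U) hc (containing w (G.avoidFun N) -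
      avoiding N (containing w (G.clusterFun v)) * G.avoidFun N)
      (avoiding N (G.clusterFun v) * containing w (G.avoidFun N))
    have h2 := wnorm_sub_le (U := U) hc (containing w (G.avoidFun N))
      (avoiding N (containing w (G.clusterFun v)) * G.avoidFun N)
    have h3 := wnorm_mul_le (U := U) hc (avoiding N (containing w (G.clusterFun v))) (G.avoidFun N)
    have h4 := wnorm_mul_le (U := U) hc (avoiding N (G.clusterFun v)) (containing w (G.avoidFun N))
    have h5 := mul_le_mul (wnorm_avoiding_le (U := U) hc N (containing w (G.clusterFun v))) hA
      hA0 hB0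
    have h6 := mul_le_mul_of_nonneg_right
      ((wnorm_avoiding_le (U := U) hc N (G.clusterFun v)).trans (h v)) hD0
    have h7 := mul_le_mul_of_nonneg_left ih (by linarith : 0 ≤ 1 + β)
    have h8 := mul_nonneg hβ (mul_nonneg hp0 hB0)
    linarith

variable [DecidableRel G.Adj]

/-- The fixed-point bound behind the cluster expansion: if `α` is at least the bound `exp (c α d)`
that it reproduces, then all norms of the functions `G.avoidFun N` with `|N| ≤ d` are at most
`α`. -/
theorem wnorm_avoidFun_le (hc : 0 ≤ c) (hα : 0 ≤ α) (hd : Real.exp (c * α * d) ≤ α)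
    (hG : ∀ v, ((G.neighborFinset v).card : ℝ) ≤ d) (U : Finset V) :
    ∀ N : Finset V, (N.card : ℝ) ≤ d → wnorm c U (G.avoidFun N) ≤ α := by
  induction U using Finset.strongInduction with
  | H U ih =>
    intro N hN
    refine (G.wnorm_avoidFun_le_pow hc (mul_nonneg hc hα) (fun v => ?_) N).trans
      (one_add_pow_le_of_exp_le hc hα hd hN)
    by_cases hv : v ∈ U
    · rw [G.wnorm_clusterFun hv]
      exact mul_le_mul_of_nonneg_left (ih _ (Finset.erase_ssubset hv) _ (hG v)) hc
    · rw [G.wnorm_clusterFun_of_notMem hv]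
      exact mul_nonneg hc hα

theorem wnorm_clusterFun_le (hc : 0 ≤ c) (hα : 0 ≤ α) (hd : Real.exp (c * α * d) ≤ α)
    (hG : ∀ v, ((G.neighborFinset v).card : ℝ) ≤ d) (U : Finset V) (v : V) :
    wnorm c U (G.clusterFun v) ≤ c * α := by
  by_cases hv : v ∈ U
  · rw [G.wnorm_clusterFun hv]
    exact mul_le_mul_of_nonneg_left (G.wnorm_avoidFun_le hc hα hd hG _ _ (hG v)) hc
  · rw [G.wnorm_clusterFun_of_notMem hv]
    exact mul_nonneg hc hα

/-! ### Self-avoiding walks and cycles -/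

/-- The number of self-avoiding walks in `U` with `l` edges from `v` to `w`. -/
def sawCount : ℕ → Finset V → V → V → ℕ
  | 0, U, v, w => if v ∈ U ∧ v = w then 1 else 0
  | l + 1, U, v, w => if v ∈ U then ∑ v' ∈ G.neighborFinset v, sawCount l (U.erase v) v' w else 0

/-- Clusters containing two given vertices are controlled by the self-avoiding walks that join
them. -/
theorem wnorm_containing_clusterFun_le (hc : 0 ≤ c) (hα : 0 ≤ α) (hd : Real.exp (c * α * d) ≤ α)
    (hG : ∀ v, ((G.neighborFinset v).card : ℝ) ≤ d) (w : V) (n : ℕ) :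
    ∀ (U : Finset V), U.card ≤ n → ∀ v, wnorm c U (containing w (G.clusterFun v)) ≤
      ∑ l ∈ Finset.range n, (c * α) ^ (l + 1) * G.sawCount l U v w := by
  have hβ : 0 ≤ c * α := mul_nonneg hc hα
  induction n with
  | zero =>
    intro U hU v
    obtain rfl : U = ∅ := by simpa using hU
    simpa using (wnorm_containing_le hc w (G.clusterFun v)).trans_eq
      (G.wnorm_clusterFun_of_notMem (Finset.notMem_empty v))
  | succ n ih =>
    intro U hU v
    by_cases hv : v ∈ U
    · rw [Finset.sum_range_succ']
      by_cases hvw : v = w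
      · subst hvw
        rw [containing_clusterFun]
        refine (G.wnorm_clusterFun_le hc hα hd hG U v).trans ?_
        simp only [sawCount, hv]
        simp only [true_and, if_true, zero_add, pow_one, Nat.cast_one, mul_one]
        exact le_add_of_nonneg_left (Finset.sum_nonneg fun _ _ => by positivity)
      · have h1 : wnorm c U (containing w (G.clusterFun v)) =
            c * wnorm c (U.erase v) (containing w (G.avoidFun (G.neighborFinset v))) := by
          have h2 : containing w (G.clusterFun v) =
              containing v (containing w (G.clusterFun v)) := by
            conv_lhs => rw [← containing_clusterFun]
            ext S
            simp only [containing_apply]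
            split_ifs <;> rfl
          rw [h2]
          refine wnorm_containing hv fun S hS => ?_
          rw [containing_apply, containing_apply, G.clusterFun_apply_insert hS]
          simp [Ne.symm hvw]
        have h3 := G.wnorm_containing_avoidFun_le hc hβ
          (fun v' => G.wnorm_clusterFun_le hc hα hd hG (U.erase v) v') w (G.neighborFinset v)
        have h4 := one_add_pow_le_of_exp_le hc hα hd (hG v)
        have h5 : ∀ v' ∈ G.neighborFinset v, _ := fun v' _ =>
          ih (U.erase v) (by rw [Finset.card_erase_of_mem hv]; omega) v'
        have h6 := Finset.sum_le_sum h5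
        have h7 : 0 ≤ ∑ v' ∈ G.neighborFinset v,
            wnorm c (U.erase v) (containing w (G.clusterFun v')) :=
          Finset.sum_nonneg fun _ _ => wnorm_nonneg hc _
        calc wnorm c U (containing w (G.clusterFun v))
            ≤ c * (α * ∑ v' ∈ G.neighborFinset v,
              wnorm c (U.erase v) (containing w (G.clusterFun v'))) := by
              rw [h1]
              exact mul_le_mul_of_nonneg_left (h3.trans (mul_le_mul_of_nonneg_right h4 h7)) hc
          _ ≤ c * α * ∑ v' ∈ G.neighborFinset v, ∑ l ∈ Finset.range n,
              (c * α) ^ (l + 1) * G.sawCount l (U.erase v) v' w := by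
              rw [← mul_assoc]
              exact mul_le_mul_of_nonneg_left h6 hβ
          _ = ∑ l ∈ Finset.range n, (c * α) ^ (l + 1 + 1) * G.sawCount (l + 1) U v w := by
              rw [Finset.sum_comm, Finset.mul_sum]
              refine Finset.sum_congr rfl fun l _ => ?_
              rw [← Finset.mul_sum, sawCount, if_pos hv]
              push_cast
              ring
          _ ≤ _ := le_add_of_nonneg_right (by positivity)
    · refine ((wnorm_containing_le hc w _).trans_eq (G.wnorm_clusterFun_of_notMem hv)).trans ?_
      exact Finset.sum_nonneg fun _ _ => by positivity

theorem sum_sawCount_le (hG : ∀ v, ((G.neighborFinset v).card : ℝ) ≤ d) (l : ℕ) :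
    ∀ (U : Finset V) (v : V), ∑ w, (G.sawCount l U v w : ℝ) ≤ d ^ l := by
  induction l with
  | zero =>
    intro U v
    by_cases hv : v ∈ U <;> simp [sawCount, hv]
  | succ l ih =>
    intro U v
    have hd : 0 ≤ d := (Nat.cast_nonneg _).trans (hG v)
    simp only [sawCount]
    split_ifs
    · push_cast
      rw [Finset.sum_comm]
      refine (Finset.sum_le_sum fun v' _ => ih (U.erase v) v').trans ?_
      rw [Finset.sum_const, nsmul_eq_mul, pow_succ']
      exact mul_le_mul_of_nonneg_right (hG v) (by positivity)
    · simp only [Nat.cast_zero, Finset.sum_const_zero]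
      positivity

/-- The self-avoiding walks in `U` with `l` edges from `v` to `w`, as sequences of vertices. -/
def sawFinset (l : ℕ) (U : Finset V) (v w : V) : Finset (Fin (l + 1) → V) :=
  Finset.univ.filter fun f => Function.Injective f ∧
    (∀ i : Fin l, G.Adj (f i.castSucc) (f i.succ)) ∧ (∀ i, f i ∈ U) ∧ f 0 = v ∧ f (Fin.last l) = w

theorem sawCount_le_card (l : ℕ) :
    ∀ (U : Finset V) (v w : V), G.sawCount l U v w ≤ (G.sawFinset l U v w).card := by
  induction l with
  | zero =>
    intro U v w
    rw [sawCount]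
    split_ifs with h
    · refine Finset.card_pos.2 ⟨fun _ => v, ?_⟩
      simp [sawFinset, h.2, Function.injective_of_subsingleton]
      exact h.2 ▸ h.1
    · exact Nat.zero_le _
  | succ l ih =>
    intro U v w
    rw [sawCount]
    split_ifs with hv
    · refine (Finset.sum_le_sum fun v' _ => ih (U.erase v) v' w).trans ?_
      rw [← Finset.card_sigma]
      refine Finset.card_le_card_of_injOn
        (fun x => (Fin.cons v x.2 : Fin (l + 1 + 1) → V)) ?_ ?_
      · rintro ⟨v', f⟩ hf
        simp only [sawFinset, Finset.coe_sigma, Set.mem_sigma_iff, Finset.mem_coe,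
          mem_neighborFinset, Finset.mem_filter, Finset.mem_univ, true_and, Finset.mem_erase] at hf ⊢
        obtain ⟨hadj, hinj, hstep, hU, h0, hl⟩ := hf
        refine ⟨Fin.cons_injective_iff.2 ⟨?_, hinj⟩, fun i => ?_, fun i => ?_, rfl, ?_⟩
        · rintro ⟨i, hi⟩
          exact (hU i).1 hi
        · refine Fin.cases ?_ (fun i => ?_) i
          · simpa [h0] using hadj
          · simpa [← Fin.succ_castSucc] using hstep i
        · exact Fin.cases (by simpa using hv) (fun i => by simpa using (hU i).2) i
        · rw [← Fin.succ_last, Fin.cons_succ, hl]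
      · rintro ⟨v₁, f₁⟩ h₁ ⟨v₂, f₂⟩ h₂ h
        simp only [sawFinset, Finset.coe_sigma, Set.mem_sigma_iff, Finset.mem_coe,
          Finset.mem_filter, Finset.mem_univ, true_and] at h₁ h₂
        obtain rfl : f₁ = f₂ := Fin.cons_right_injective (α := fun _ => V) v h
        obtain rfl : v₁ = v₂ := h₁.2.2.2.2.1.symm.trans h₂.2.2.2.2.1
        rfl
    · exact Nat.zero_le _

/-- A closed walk visiting `k + 3` vertices in turn, as a homomorphism from a cycle. -/
def cycleHom (k : ℕ) (f : Fin (k + 3) → V)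
    (hf : ∀ i : Fin (k + 2), G.Adj (f i.castSucc) (f i.succ)) (h : G.Adj (f (Fin.last _)) (f 0)) :
    cycleGraph (k + 3) →g G where
  toFun := f
  map_rel' := by
    have key : ∀ i : Fin (k + 3), G.Adj (f i) (f (i + 1)) := by
      intro i
      refine Fin.lastCases ?_ (fun i => ?_) i
      · rwa [Fin.last_add_one]
      · rw [Fin.coeSucc_eq_succ]
        exact hf i
    intro a b hab
    rw [cycleGraph_adj] at hab
    rcases hab with hab | hab
    · rw [sub_eq_iff_eq_add'.1 hab]
      exact (key b).symm
    · rw [sub_eq_iff_eq_add'.1 hab]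
      exact key a

/-- Closing up a self-avoiding walk between two neighbours of `u` that avoids `u` gives a cycle. -/
theorem sum_sawCount_le_card_cycle (k : ℕ) :
    ∑ u, ∑ v ∈ G.neighborFinset u, ∑ w ∈ G.neighborFinset u,
      G.sawCount (k + 1) (Finset.univ.erase u) v w ≤
      Nat.card {f : cycleGraph (k + 3) →g G // Function.Injective f} := by
  calc _ ≤ ∑ u, ∑ v ∈ G.neighborFinset u, ∑ w ∈ G.neighborFinset u,
        (G.sawFinset (k + 1) (Finset.univ.erase u) v w).card :=
        Finset.sum_le_sum fun u _ => Finset.sum_le_sum fun v _ => Finset.sum_le_sum fun w _ =>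
          G.sawCount_le_card _ _ _ _
    _ = (Finset.univ.sigma fun u => (G.neighborFinset u).sigma fun v =>
          (G.neighborFinset u).sigma fun w =>
            G.sawFinset (k + 1) (Finset.univ.erase u) v w).card := by
        simp only [Finset.card_sigma]
    _ ≤ _ := by
        have : Finite (cycleGraph (k + 3) →g G) := DFunLike.finite _
        rw [← Fintype.card_coe, ← Nat.card_eq_fintype_card]
        have key : ∀ x ∈ (Finset.univ.sigma fun u => (G.neighborFinset u).sigma fun v =>
            (G.neighborFinset u).sigma fun w => G.sawFinset (k + 1) (Finset.univ.erase u) v w),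
            Function.Injective (Fin.cons x.1 x.2.2.2 : Fin (k + 3) → V) ∧
            (∀ i : Fin (k + 2), G.Adj ((Fin.cons x.1 x.2.2.2 : Fin (k + 3) → V) i.castSucc)
              ((Fin.cons x.1 x.2.2.2 : Fin (k + 3) → V) i.succ)) ∧
            G.Adj ((Fin.cons x.1 x.2.2.2 : Fin (k + 3) → V) (Fin.last _))
              ((Fin.cons x.1 x.2.2.2 : Fin (k + 3) → V) 0) ∧
            x.2.2.2 0 = x.2.1 ∧ x.2.2.2 (Fin.last _) = x.2.2.1 := by
          rintro ⟨u, v, w, f⟩ hx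
          simp only [sawFinset, Finset.mem_sigma, Finset.mem_univ, true_and, mem_neighborFinset,
            Finset.mem_filter, Finset.mem_erase] at hx
          obtain ⟨hv, hw, hinj, hstep, hU, h0, hl⟩ := hx
          refine ⟨Fin.cons_injective_iff.2 ⟨?_, hinj⟩, fun i => ?_, ?_, h0, hl⟩
          · rintro ⟨i, hi⟩
            exact (hU i).1 hi
          · refine Fin.cases ?_ (fun i => ?_) i
            · simpa [h0] using hv
            · simpa [← Fin.succ_castSucc] using hstep i
          · rw [← Fin.succ_last, Fin.cons_succ]
            change G.Adj (f _) u
            rw [hl]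
            exact hw.symm
        refine Nat.card_le_card_of_injective (fun x => ⟨G.cycleHom k (Fin.cons x.1.1 x.1.2.2.2)
          (key x.1 x.2).2.1 (key x.1 x.2).2.2.1, (key x.1 x.2).1⟩) ?_
        rintro ⟨⟨u₁, v₁, w₁, f₁⟩, h₁⟩ ⟨⟨u₂, v₂, w₂, f₂⟩, h₂⟩ h
        have h' : (Fin.cons u₁ f₁ : Fin (k + 3) → V) = Fin.cons u₂ f₂ :=
          congrArg (fun g => (g.1 : Fin (k + 3) → V)) h
        obtain ⟨rfl, rfl⟩ := Fin.cons_injective2 h'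
        obtain rfl : v₁ = v₂ := (key _ h₁).2.2.2.1.symm.trans (key _ h₂).2.2.2.1
        obtain rfl : w₁ = w₂ := (key _ h₁).2.2.2.2.symm.trans (key _ h₂).2.2.2.2
        rfl

end norms

end SimpleGraph

/-! ### Ratios of chromatic polynomials -/

namespace SetFunction

variable {V : Type*} [DecidableEq V]

theorem norm_mul_apply_le {c C : ℝ} {U : Finset V} (f g : SetFunction V)
    (hg : ∀ T ⊆ U, ‖g (U \ T)‖ ≤ c ^ T.card * C) : ‖(f * g) U‖ ≤ wnorm c U f * C := by
  rw [mul_apply, wnorm, Finset.sum_mul]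
  refine (norm_sum_le _ _).trans (Finset.sum_le_sum fun T hT => ?_)
  rw [norm_mul, mul_assoc]
  exact mul_le_mul_of_nonneg_left (hg T (Finset.mem_powerset.1 hT)) (norm_nonneg _)

theorem wnorm_sub_one {c : ℝ} {U : Finset V} {f : SetFunction V} (hf : f ∅ = 1) :
    wnorm c U (f - 1) = wnorm c U f - 1 := by
  rw [wnorm, wnorm, ← Finset.add_sum_erase _ _ (Finset.empty_mem_powerset U),
    ← Finset.add_sum_erase _ _ (Finset.empty_mem_powerset U)]
  have : ∀ S ∈ U.powerset.erase ∅, ‖(f - 1) S‖ * c ^ S.card = ‖f S‖ * c ^ S.card := by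
    intro S hS
    simp [one_apply, Finset.ne_of_mem_erase hS]
  rw [Finset.sum_congr rfl this]
  simp [hf, one_apply]

/-- Splitting the sets that meet `N` according to the vertices of `N` that they contain. -/
theorem wnorm_sub_avoiding_le {c : ℝ} (hc : 0 ≤ c) {U : Finset V} (N : Finset V)
    (f : SetFunction V) :
    wnorm c U (f - avoiding N f) ≤ ∑ w ∈ N, wnorm c U (containing w f) := by
  simp only [wnorm]
  rw [Finset.sum_comm]
  refine Finset.sum_le_sum fun S _ => ?_
  rw [← Finset.sum_mul]
  refine mul_le_mul_of_nonneg_right ?_ (by positivity)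
  rw [sub_apply, avoiding_apply]
  split_ifs with h
  · simp only [sub_self, norm_zero]
    exact Finset.sum_nonneg fun _ _ => norm_nonneg _
  · obtain ⟨w, hwS, hwN⟩ := Finset.not_disjoint_iff.1 h
    refine le_trans ?_ (Finset.single_le_sum
      (f := fun w => ‖containing w f S‖) (fun _ _ => norm_nonneg _) hwN)
    simp [containing_apply, hwS]

end SetFunction

theorem Complex.abs_log_norm_one_add_le {z : ℂ} (hz : ‖z‖ ≤ 1 / 2) :
    |Real.log ‖1 + z‖| ≤ 2 * ‖z‖ := by
  have h1 : ‖1 + z‖ ≤ 1 + ‖z‖ := (norm_add_le _ _).trans_eq (by simp)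
  have h2 : 1 - ‖z‖ ≤ ‖1 + z‖ := by
    have := norm_sub_norm_le (1 : ℂ) (-z)
    simpa using this
  have h0 : 0 < ‖1 + z‖ := by linarith
  rw [abs_le]
  constructor
  · have h3 := Real.one_sub_inv_le_log_of_pos h0
    have h4 : ‖1 + z‖⁻¹ ≤ 1 + 2 * ‖z‖ := by
      rw [inv_le_iff_one_le_mul₀ h0]
      nlinarith [norm_nonneg z]
    linarith
  · have := Real.log_le_sub_one_of_pos h0
    linarith [norm_nonneg z]

namespace SimpleGraph

open SetFunction

variable {V : Type*} [Fintype V] [DecidableEq V] (G : SimpleGraph V)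

/-- For `N` the neighbourhood of a vertex `u ∉ U`, the chromatic polynomial of the subgraph induced
on `insert u U`, divided by `q`. In general the neighbourhood of `u` is replaced by `N`, so that
the edges at `u` can be added one at a time. -/
noncomputable def attachFun (q : ℂ) (N : Finset V) : SetFunction V :=
  G.avoidFun N * G.chromaticFun q

theorem attachFun_empty (q : ℂ) : G.attachFun q ∅ = G.chromaticFun q := by
  rw [attachFun, avoidFun_empty, one_mul]

theorem chromaticFun_apply_insert [DecidableRel G.Adj] (q : ℂ) {u : V} {U : Finset V}
    (hu : u ∉ U) :
    G.chromaticFun q (insert u U) = q * G.attachFun q (G.neighborFinset u) U := by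
  have h := congrArg (fun f : SetFunction V => f (insert u U)) (G.containing_chromaticFun u q)
  simp only [containing_apply, Finset.mem_insert_self, if_true, smul_apply] at h
  rw [h, ← containing_clusterFun, containing_mul_apply_insert hu, attachFun, mul_apply]
  congr 1
  refine Finset.sum_congr rfl fun T hT => ?_
  rw [G.clusterFun_apply_insert fun h => hu (Finset.mem_powerset.1 hT h)]

theorem attachFun_insert_of_notMem (q : ℂ) (N : Finset V) {v : V} {U : Finset V} (hv : v ∉ U) :
    G.attachFun q (insert v N) U = G.attachFun q N U := by
  rw [attachFun, avoidFun_insert, sub_mul, sub_apply, ← attachFun, mul_assoc, ← attachFun,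
    sub_eq_self, mul_apply]
  refine Finset.sum_eq_zero fun T hT => ?_
  rw [← containing_clusterFun, avoiding_apply, containing_apply,
    if_neg fun h => hv (Finset.mem_powerset.1 hT h), ite_self, zero_mul]

/-- The effect of adding one edge: the factor `1 - 1 / q` that a bridge would contribute, and a
correction from the clusters at `v` that meet `N` and hence close a cycle. -/
theorem attachFun_insert {q : ℂ} (hq : q ≠ 0) (N : Finset V) {v : V} {U : Finset V} (hv : v ∈ U) :
    G.attachFun q (insert v N) U = (1 - 1 / q) * (G.attachFun q N U +
      ((G.clusterFun v - avoiding N (G.clusterFun v)) * G.attachFun q N) U) := by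
  have h1 : G.attachFun q (insert v N) =
      G.attachFun q N - avoiding N (G.clusterFun v) * G.attachFun q N := by
    rw [attachFun, avoidFun_insert, attachFun]
    ring
  have h2 : containing v (G.attachFun q N) =
      q • (G.clusterFun v * G.attachFun q N) -
        (G.clusterFun v - avoiding N (G.clusterFun v)) * G.attachFun q N := by
    rw [attachFun, containing_mul, containing_chromaticFun, containing_avoidFun, mul_smul_comm,
      mul_left_comm (G.avoidFun N)]
    ring
  have h3 := congrArg (fun f : SetFunction V => f U) h1
  have h4 := congrArg (fun f : SetFunction V => f U) h2
  simp only [containing_apply, if_pos hv, sub_apply, smul_apply, sub_mul] at h3 h4 ⊢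
  rw [h3]
  field_simp
  linear_combination h4

section ratios

variable [DecidableRel G.Adj] {q : ℂ} {d : ℝ}

/-- The constants of the zero-free region. All norms are taken with weight `c = 3 / (2 ‖q‖)`, and the
fixed-point bound is applied with `α = 4 / 3`. The two are linked by `c = 1 / ((2 - α) ‖q‖)`: if the
norms are at most `α`, then adding a vertex multiplies the chromatic polynomial by at least
`(2 - α) ‖q‖ = 1 / c`. -/
theorem exp_cluster_le (hd : 1 ≤ d) (hq : 8 * d ≤ ‖q‖) :
    Real.exp (3 / (2 * ‖q‖) * (4 / 3) * d) ≤ 4 / 3 := by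
  have hq0 : 0 < ‖q‖ := by linarith
  have h1 : 3 / (2 * ‖q‖) * (4 / 3) * d ≤ 1 / 4 := by
    rw [show 3 / (2 * ‖q‖) * (4 / 3) * d = 2 * d / ‖q‖ by field_simp; ring, div_le_iff₀ hq0]
    linarith
  refine (Real.exp_le_exp.2 h1).trans ?_
  rw [← pow_le_pow_iff_left₀ (Real.exp_pos _).le (by norm_num) (n := 4) (by norm_num),
    ← Real.exp_nat_mul]
  have := Real.exp_one_lt_d9
  norm_num at this ⊢
  linarith

theorem norm_attachFun_sub_le (hd : 1 ≤ d) (hq : 8 * d ≤ ‖q‖)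
    (hG : ∀ v, ((G.neighborFinset v).card : ℝ) ≤ d) {U : Finset V}
    (hU : ∀ T ⊆ U, ‖G.chromaticFun q (U \ T)‖ ≤
      (3 / (2 * ‖q‖)) ^ T.card * ‖G.chromaticFun q U‖)
    {N : Finset V} (hN : (N.card : ℝ) ≤ d) :
    ‖G.attachFun q N U - G.chromaticFun q U‖ ≤ 1 / 3 * ‖G.chromaticFun q U‖ := by
  have h1 : G.attachFun q N U - G.chromaticFun q U =
      ((G.avoidFun N - 1) * G.chromaticFun q) U := by
    rw [sub_mul, one_mul, sub_apply, attachFun]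
  rw [h1]
  refine (norm_mul_apply_le _ _ hU).trans (mul_le_mul_of_nonneg_right ?_ (norm_nonneg _))
  rw [wnorm_sub_one (G.avoidFun_apply_empty N)]
  have := G.wnorm_avoidFun_le (by positivity) (by norm_num) (exp_cluster_le hd hq) hG U N hN
  linarith

/-- Quantitative zero-freeness for `‖q‖ ≥ 8 d`: by induction, each vertex multiplies the chromatic
polynomial by at least `2 ‖q‖ / 3`. -/
theorem norm_chromaticFun_sdiff_le (hd : 1 ≤ d) (hq : 8 * d ≤ ‖q‖)
    (hG : ∀ v, ((G.neighborFinset v).card : ℝ) ≤ d) (U : Finset V) :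
    ∀ T ⊆ U, ‖G.chromaticFun q (U \ T)‖ ≤
      (3 / (2 * ‖q‖)) ^ T.card * ‖G.chromaticFun q U‖ := by
  have hq0 : 0 < ‖q‖ := by linarith
  induction U using Finset.strongInduction with
  | H U ih =>
    intro T hT
    rcases T.eq_empty_or_nonempty with rfl | ⟨u, hu⟩
    · simp
    · have h1 := ih _ (Finset.erase_ssubset (hT hu))
      have h2 := h1 (T.erase u) (Finset.erase_subset_erase u hT)
      have h3 := G.norm_attachFun_sub_le hd hq hG h1 (hG u)
      have h4 := G.chromaticFun_apply_insert q (Finset.notMem_erase u U)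
      rw [Finset.insert_erase (hT hu)] at h4
      have h5 : 2 / 3 * ‖G.chromaticFun q (U.erase u)‖ ≤
          ‖G.attachFun q (G.neighborFinset u) (U.erase u)‖ := by
        have := norm_sub_norm_le (G.chromaticFun q (U.erase u))
          (G.attachFun q (G.neighborFinset u) (U.erase u))
        rw [norm_sub_rev] at this
        linarith
      have h6 : ‖G.chromaticFun q (U.erase u)‖ ≤ 3 / (2 * ‖q‖) * ‖G.chromaticFun q U‖ := by
        rw [h4, norm_mul, show ∀ x, 3 / (2 * ‖q‖) * (‖q‖ * x) = 3 / 2 * x by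
          intro x; field_simp]
        linarith
      have h7 : U.erase u \ T.erase u = U \ T := by
        ext x
        by_cases hx : x = u <;> simp [hx, hu]
      rw [h7] at h2
      refine h2.trans ?_
      rw [← Finset.card_erase_add_one hu, pow_succ, mul_assoc]
      exact mul_le_mul_of_nonneg_left h6 (by positivity)

theorem chromaticFun_ne_zero (hd : 1 ≤ d) (hq : 8 * d ≤ ‖q‖)
    (hG : ∀ v, ((G.neighborFinset v).card : ℝ) ≤ d) (U : Finset V) : G.chromaticFun q U ≠ 0 := by
  intro h
  have := G.norm_chromaticFun_sdiff_le hd hq hG U U le_rfl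
  rw [h, sdiff_self, Finset.bot_eq_empty, chromaticFun_empty] at this
  norm_num at this

theorem norm_attachFun_bounds (hd : 1 ≤ d) (hq : 8 * d ≤ ‖q‖)
    (hG : ∀ v, ((G.neighborFinset v).card : ℝ) ≤ d) (U : Finset V)
    {N : Finset V} (hN : (N.card : ℝ) ≤ d) :
    2 / 3 * ‖G.chromaticFun q U‖ ≤ ‖G.attachFun q N U‖ ∧
      ‖G.attachFun q N U‖ ≤ 4 / 3 * ‖G.chromaticFun q U‖ := by
  have h := G.norm_attachFun_sub_le hd hq hG (G.norm_chromaticFun_sdiff_le hd hq hG U) hN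
  have h1 := norm_sub_norm_le (G.attachFun q N U) (G.chromaticFun q U)
  have h2 := norm_sub_norm_le (G.chromaticFun q U) (G.attachFun q N U)
  rw [norm_sub_rev] at h2
  exact ⟨by linarith, by linarith⟩

theorem attachFun_ne_zero (hd : 1 ≤ d) (hq : 8 * d ≤ ‖q‖)
    (hG : ∀ v, ((G.neighborFinset v).card : ℝ) ≤ d) (U : Finset V)
    {N : Finset V} (hN : (N.card : ℝ) ≤ d) : G.attachFun q N U ≠ 0 := by
  have h1 := (G.norm_attachFun_bounds hd hq hG U hN).1
  have h2 := norm_pos_iff.2 (G.chromaticFun_ne_zero hd hq hG U)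
  exact norm_pos_iff.1 (by linarith)

/-- The clusters that contain `v` and meet `N \ {v}` bound the deviation of the effect of one edge
from that of a bridge. -/
theorem abs_log_attachFun_insert_sub_le (hd : 1 ≤ d) (hq : 8 * d ≤ ‖q‖)
    (hG : ∀ v, ((G.neighborFinset v).card : ℝ) ≤ d) {U : Finset V} {v : V} (hv : v ∈ U)
    {N : Finset V} (hN : (N.card : ℝ) ≤ d) :
    |Real.log ‖G.attachFun q (insert v N) U‖ - Real.log ‖G.attachFun q N U‖ -
      Real.log ‖1 - 1 / q‖| ≤
      4 * ∑ w ∈ N, wnorm (3 / (2 * ‖q‖)) U (containing w (G.clusterFun v)) := by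
  have hq0 : 0 < ‖q‖ := by linarith
  have hq1 : q ≠ 0 := norm_pos_iff.1 hq0
  have hc : 0 ≤ 3 / (2 * ‖q‖) := by positivity
  set m := G.clusterFun v - avoiding N (G.clusterFun v) with hm
  have hne := G.attachFun_ne_zero hd hq hG U hN
  have hpos := norm_pos_iff.2 hne
  have h1 : ‖(m * G.attachFun q N) U‖ ≤
      wnorm (3 / (2 * ‖q‖)) U m * (2 * ‖G.attachFun q N U‖) := by
    refine norm_mul_apply_le _ _ fun T hT => ?_
    have h2 := (G.norm_attachFun_bounds hd hq hG (U \ T) hN).2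
    have h3 := G.norm_chromaticFun_sdiff_le hd hq hG U T hT
    have h4 := (G.norm_attachFun_bounds hd hq hG U hN).1
    have h5 : 0 ≤ (3 / (2 * ‖q‖)) ^ T.card := by positivity
    have h6 := mul_le_mul_of_nonneg_left h4 h5
    linarith
  -- This bound, unlike the one by the clusters that close a cycle, makes `‖z‖` small for each
  -- edge, so that the logarithm below can be estimated linearly.
  have h2 : wnorm (3 / (2 * ‖q‖)) U m ≤ 2 / ‖q‖ := by
    have h3 : wnorm (3 / (2 * ‖q‖)) U m ≤ wnorm (3 / (2 * ‖q‖)) U (G.clusterFun v) :=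
      wnorm_le_wnorm hc fun S => by
        rw [hm, sub_apply, avoiding_apply]
        split_ifs <;> simp
    have h4 := G.wnorm_clusterFun_le hc (by norm_num) (exp_cluster_le hd hq) hG U v
    refine (h3.trans h4).trans_eq ?_
    field_simp
    norm_num
  have h3 := wnorm_sub_avoiding_le hc (U := U) N (G.clusterFun v)
  rw [← hm] at h3
  set z := (m * G.attachFun q N) U / G.attachFun q N U with hz
  have hz1 : ‖z‖ ≤ 2 * wnorm (3 / (2 * ‖q‖)) U m := by
    rw [hz, norm_div, div_le_iff₀ hpos]
    linarith
  have hz2 : ‖z‖ ≤ 1 / 2 := by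
    have : 2 / ‖q‖ ≤ 1 / 4 := by
      rw [div_le_iff₀ hq0]
      linarith
    linarith
  have h4 : G.attachFun q (insert v N) U = G.attachFun q N U * (1 - 1 / q) * (1 + z) := by
    rw [G.attachFun_insert hq1 N hv, ← hm, hz]
    field_simp
  have h5 : (1 : ℂ) - 1 / q ≠ 0 := by
    intro h
    have : q = 1 := by
      field_simp at h
      linear_combination h
    rw [this, norm_one] at hq
    linarith
  have h6 : 1 + z ≠ 0 := by
    intro h
    have h7 : z = -1 := by linear_combination h
    rw [h7] at hz2
    norm_num at hz2
  rw [h4, norm_mul, norm_mul, Real.log_mul (by positivity) (by positivity),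
    Real.log_mul (by positivity) (by positivity)]
  have h7 := Complex.abs_log_norm_one_add_le hz2
  rw [show ∀ a b c : ℝ, a + b + c - a - b = c by intros; ring]
  linarith

theorem abs_log_attachFun_sub_le (hd : 1 ≤ d) (hq : 8 * d ≤ ‖q‖)
    (hG : ∀ v, ((G.neighborFinset v).card : ℝ) ≤ d) (U N : Finset V) (hN : (N.card : ℝ) ≤ d) :
    |Real.log ‖G.attachFun q N U‖ - Real.log ‖G.chromaticFun q U‖ -
      (N ∩ U).card * Real.log ‖1 - 1 / q‖| ≤
      4 * ∑ v ∈ N, ∑ w ∈ N.erase v, wnorm (3 / (2 * ‖q‖)) U (containing w (G.clusterFun v)) := by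
  have hq0 : 0 < ‖q‖ := by linarith
  have hc : 0 ≤ 3 / (2 * ‖q‖) := by positivity
  induction N using Finset.induction_on with
  | empty => simp [attachFun_empty]
  | insert v N hv ih =>
    have hN' : (N.card : ℝ) ≤ d := by
      rw [Finset.card_insert_of_notMem hv] at hN
      push_cast at hN
      linarith
    have ih := ih hN'
    have h1 : ∑ v ∈ N, ∑ w ∈ N.erase v,
        wnorm (3 / (2 * ‖q‖)) U (containing w (G.clusterFun v)) ≤
        ∑ v' ∈ N, ∑ w ∈ (insert v N).erase v',
        wnorm (3 / (2 * ‖q‖)) U (containing w (G.clusterFun v')) :=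
      Finset.sum_le_sum fun v' _ => Finset.sum_le_sum_of_subset_of_nonneg
        (Finset.erase_subset_erase _ (Finset.subset_insert _ _)) fun _ _ _ => wnorm_nonneg hc _
    rw [Finset.sum_insert hv, Finset.erase_insert hv]
    have h2 : 0 ≤ ∑ w ∈ N, wnorm (3 / (2 * ‖q‖)) U (containing w (G.clusterFun v)) :=
      Finset.sum_nonneg fun _ _ => wnorm_nonneg hc _
    by_cases hvU : v ∈ U
    · have h3 := G.abs_log_attachFun_insert_sub_le hd hq hG hvU hN'
      rw [Finset.insert_inter_of_mem hvU,
        Finset.card_insert_of_notMem fun h => hv (Finset.mem_inter.1 h).1]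
      push_cast
      rw [abs_le] at ih h3 ⊢
      constructor <;> linarith
    · rw [G.attachFun_insert_of_notMem q N hvU, Finset.insert_inter_of_notMem hvU]
      linarith

/-- Building up the graph vertex by vertex and edge by edge. The double sum over `U` counts each
edge twice. -/
theorem abs_log_chromaticFun_sub_le (hd : 1 ≤ d) (hq : 8 * d ≤ ‖q‖)
    (hG : ∀ v, ((G.neighborFinset v).card : ℝ) ≤ d) (U : Finset V) :
    |Real.log ‖G.chromaticFun q U‖ - U.card * Real.log ‖q‖ -
      (∑ u ∈ U, ((G.neighborFinset u ∩ U).card : ℝ)) / 2 * Real.log ‖1 - 1 / q‖| ≤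
      4 * ∑ u ∈ U, ∑ v ∈ G.neighborFinset u, ∑ w ∈ (G.neighborFinset u).erase v,
        wnorm (3 / (2 * ‖q‖)) (Finset.univ.erase u) (containing w (G.clusterFun v)) := by
  have hq0 : 0 < ‖q‖ := by linarith
  have hc : 0 ≤ 3 / (2 * ‖q‖) := by positivity
  induction U using Finset.induction_on with
  | empty => simp [chromaticFun_empty]
  | insert u U hu ih =>
    have h1 := G.abs_log_attachFun_sub_le hd hq hG U _ (hG u)
    have h2 : ∑ v ∈ G.neighborFinset u, ∑ w ∈ (G.neighborFinset u).erase v,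
        wnorm (3 / (2 * ‖q‖)) U (containing w (G.clusterFun v)) ≤
        ∑ v ∈ G.neighborFinset u, ∑ w ∈ (G.neighborFinset u).erase v,
        wnorm (3 / (2 * ‖q‖)) (Finset.univ.erase u) (containing w (G.clusterFun v)) :=
      Finset.sum_le_sum fun v _ => Finset.sum_le_sum fun w _ => wnorm_mono hc
        (fun x hx => Finset.mem_erase.2 ⟨ne_of_mem_of_not_mem hx hu, Finset.mem_univ x⟩) _
    have h3 : ∑ x ∈ insert u U, ((G.neighborFinset x ∩ insert u U).card : ℝ) =
        ∑ x ∈ U, ((G.neighborFinset x ∩ U).card : ℝ) + 2 * (G.neighborFinset u ∩ U).card := by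
      have h4 : ∀ x ∈ U, ((G.neighborFinset x ∩ insert u U).card : ℝ) =
          (G.neighborFinset x ∩ U).card + if x ∈ G.neighborFinset u then 1 else 0 := by
        intro x _
        by_cases hx : G.Adj x u
        · rw [Finset.inter_insert_of_mem (by simpa using hx),
            Finset.card_insert_of_notMem fun h => hu (Finset.mem_inter.1 h).2,
            if_pos (by simpa using hx.symm)]
          push_cast
          rfl
        · rw [Finset.inter_insert_of_notMem (by simpa using hx),
            if_neg (by simpa using fun h => hx h.symm), add_zero]
      rw [Finset.sum_insert hu, Finset.sum_congr rfl h4, Finset.sum_add_distrib,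
        Finset.inter_insert_of_notMem (by simp), Finset.sum_boole, Finset.inter_comm,
        Finset.filter_mem_eq_inter]
      ring
    have hne := G.attachFun_ne_zero hd hq hG U (hG u)
    rw [G.chromaticFun_apply_insert q hu, norm_mul, Real.log_mul hq0.ne' (by positivity),
      h3, Finset.sum_insert hu, Finset.card_insert_of_notMem hu]
    push_cast
    rw [abs_le] at ih h1 ⊢
    constructor <;> linarith

/-- The number of self-avoiding walks with `l` edges that avoid a vertex `u` and join two of its
neighbours, summed over `u`. For `l ≥ 1` these are the oriented cycles on `l + 2` vertices with a
marked vertex. -/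
def closedSawCount (l : ℕ) : ℕ :=
  ∑ u, ∑ v ∈ G.neighborFinset u, ∑ w ∈ G.neighborFinset u,
    G.sawCount l (Finset.univ.erase u) v w

theorem closedSawCount_le (hG : ∀ v, ((G.neighborFinset v).card : ℝ) ≤ d) (l : ℕ) :
    (G.closedSawCount l : ℝ) ≤ Fintype.card V * d ^ (l + 1) := by
  rw [closedSawCount]
  push_cast
  refine (Finset.sum_le_card_nsmul _ _ (d ^ (l + 1)) fun u _ => ?_).trans_eq
    (by rw [nsmul_eq_mul, Finset.card_univ])
  have hd : 0 ≤ d := (Nat.cast_nonneg _).trans (hG u)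
  refine (Finset.sum_le_card_nsmul _ _ (d ^ l) fun v _ => ?_).trans ?_
  · exact (Finset.sum_le_sum_of_subset_of_nonneg (Finset.subset_univ _)
      fun _ _ _ => by positivity).trans (G.sum_sawCount_le hG l _ v)
  · rw [nsmul_eq_mul, pow_succ']
    exact mul_le_mul_of_nonneg_right (hG u) (by positivity)

theorem abs_log_chromaticPolynomial_sub_le (hd : 1 ≤ d) (hq : 8 * d ≤ ‖q‖)
    (hG : ∀ v, ((G.neighborFinset v).card : ℝ) ≤ d) :
    |Real.log ‖Polynomial.aeval q G.chromaticPolynomial‖ - Fintype.card V * Real.log ‖q‖ -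
      (∑ u, (G.degree u : ℝ)) / 2 * Real.log ‖1 - 1 / q‖| ≤
      4 * ∑ k ∈ Finset.range (Fintype.card V),
        (2 / ‖q‖) ^ (k + 2) * G.closedSawCount (k + 1) := by
  have hq0 : 0 < ‖q‖ := by linarith
  have hc : 0 ≤ 3 / (2 * ‖q‖) := by positivity
  have h1 := G.abs_log_chromaticFun_sub_le hd hq hG Finset.univ
  simp only [chromaticFun_univ, Finset.inter_univ, card_neighborFinset_eq_degree,
    Finset.card_univ] at h1
  refine h1.trans ?_
  gcongr
  have hβ : 3 / (2 * ‖q‖) * (4 / 3) = 2 / ‖q‖ := by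
    field_simp
    norm_num
  have h2 : ∀ u, ∀ v, ∀ w ∈ (G.neighborFinset u).erase v,
      wnorm (3 / (2 * ‖q‖)) (Finset.univ.erase u) (containing w (G.clusterFun v)) ≤
      ∑ k ∈ Finset.range (Fintype.card V),
        (2 / ‖q‖) ^ (k + 2) * G.sawCount (k + 1) (Finset.univ.erase u) v w := by
    intro u v w hw
    have h3 := G.wnorm_containing_clusterFun_le hc (by norm_num) (exp_cluster_le hd hq) hG w
      (Fintype.card V + 1) (Finset.univ.erase u) ((Finset.card_le_univ _).trans (Nat.le_succ _)) v
    rw [Finset.sum_range_succ', hβ] at h3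
    have h4 : G.sawCount 0 (Finset.univ.erase u) v w = 0 := by
      rw [sawCount, if_neg]
      rintro ⟨-, rfl⟩
      simp at hw
    rw [h4, Nat.cast_zero, mul_zero, add_zero] at h3
    exact h3
  calc _ ≤ ∑ u, ∑ v ∈ G.neighborFinset u, ∑ w ∈ G.neighborFinset u,
        ∑ k ∈ Finset.range (Fintype.card V),
        (2 / ‖q‖) ^ (k + 2) * (G.sawCount (k + 1) (Finset.univ.erase u) v w : ℝ) := by
        refine Finset.sum_le_sum fun u _ => Finset.sum_le_sum fun v _ => ?_
        exact (Finset.sum_le_sum (h2 u v)).trans (Finset.sum_le_sum_of_subset_of_nonneg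
          (Finset.erase_subset _ _) fun _ _ _ => Finset.sum_nonneg fun _ _ => by positivity)
    _ = _ := by
        simp only [closedSawCount, Nat.cast_sum, Finset.mul_sum]
        rw [Finset.sum_comm]
        simp only [Finset.sum_comm (s := Finset.range _)]

end ratios

end SimpleGraph

/-! ### The limit -/

theorem SimpleGraph.card_hom_completeGraph_fin_two {V : Type*} [Fintype V] (G : SimpleGraph V)
    [DecidableRel G.Adj] :
    Nat.card (SimpleGraph.completeGraph (Fin 2) →g G) = ∑ v, G.degree v := by
  classical
  rw [← G.dart_card_eq_sum_degrees, ← Nat.card_eq_fintype_card]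
  refine Nat.card_congr
    { toFun := fun f => ⟨(f 0, f 1), f.map_rel' (by simp [SimpleGraph.completeGraph])⟩
      invFun := fun e => ⟨![e.fst, e.snd], ?_⟩
      left_inv := fun f => ?_
      right_inv := fun e => rfl }
  · intro a b hab
    have hab : a ≠ b := hab
    fin_cases a <;> fin_cases b
    · exact absurd rfl hab
    · exact e.adj
    · exact e.adj.symm
    · exact absurd rfl hab
  · ext a
    fin_cases a <;> rfl

theorem tendsto_mul_log_norm_one_sub_div {d : ℕ → ℝ} (hd : Tendsto d atTop atTop) (ξ : ℂ) :
    Tendsto (fun n => d n * Real.log ‖1 - 1 / (ξ * (d n : ℂ))‖) atTop (𝓝 (-(1 / ξ).re)) := by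
  have h1 : Tendsto (fun x : ℝ => (x : ℂ) * Complex.log (1 + -(1 / ξ) / x)) atTop
      (𝓝 (-(1 / ξ))) := by
    refine Complex.tendsto_mul_log_one_add_of_tendsto (tendsto_const_nhds.congr' ?_)
    filter_upwards [eventually_ne_atTop 0] with x hx
    rw [mul_div_cancel₀ _ (Complex.ofReal_ne_zero.2 hx)]
  have h2 := (Complex.continuous_re.tendsto _).comp (h1.comp hd)
  refine h2.congr' ?_
  filter_upwards with n
  simp only [Function.comp_apply, Complex.re_ofReal_mul, Complex.log_re]
  congr 3
  rw [neg_div, div_div, ← sub_eq_add_neg]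

theorem mainTheorem3 {V : ℕ → Type*} [∀ n, Fintype (V n)] [∀ n, Nonempty (V n)]
    (G : ∀ n, SimpleGraph (V n)) (d : ℕ → ℝ)
    (hgirth : HasLargeEssentialGirth G d)
    (hd : Tendsto d atTop atTop)
    (t : ℝ)
    (ht : Tendsto (fun n => (SimpleGraph.completeGraph (Fin 2)).homDensity (G n) (d n))
      atTop (𝓝 t))
    (ξ : ℂ) (hξ : 8 ≤ ‖ξ‖) :
    Tendsto
      (fun n => ‖Polynomial.aeval (ξ * (d n : ℂ)) (G n).chromaticPolynomial‖ ^
          (1 / (Fintype.card (V n) : ℝ)) / (‖ξ‖ * d n))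
      atTop (𝓝 (Real.exp (-t * (1 / (2 * ξ)).re))) := by
  classical
  have hd1 : ∀ n, 1 ≤ d n := fun n => (hgirth.admissible n).1
  have hd0 : ∀ n, 0 < d n := fun n => one_pos.trans_le (hd1 n)
  have hG : ∀ n v, (((G n).neighborFinset v).card : ℝ) ≤ d n := fun n v => by
    have := (hgirth.admissible n).2 v
    rwa [Set.ncard_eq_toFinset_card'] at this
  have hξ0 : 0 < ‖ξ‖ := by linarith
  have hN : ∀ n, 0 < (Fintype.card (V n) : ℝ) := fun n => Nat.cast_pos.2 Fintype.card_pos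
  have hqn : ∀ n, ‖ξ * (d n : ℂ)‖ = ‖ξ‖ * d n := fun n => by
    rw [norm_mul, Complex.norm_real, Real.norm_of_nonneg (hd0 n).le]
  have hq : ∀ n, 8 * d n ≤ ‖ξ * (d n : ℂ)‖ := fun n => by
    rw [hqn]
    exact mul_le_mul_of_nonneg_right hξ (hd0 n).le
  have hP : ∀ n, 0 < ‖Polynomial.aeval (ξ * (d n : ℂ)) (G n).chromaticPolynomial‖ := fun n => by
    rw [← SimpleGraph.chromaticFun_univ]
    exact norm_pos_iff.2 ((G n).chromaticFun_ne_zero (hd1 n) (hq n) (hG n) _)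
  set L : ℕ → ℝ := fun n => Real.log ‖Polynomial.aeval (ξ * (d n : ℂ)) (G n).chromaticPolynomial‖
  set m : ℕ → ℝ := fun n => (∑ u, ((G n).degree u : ℝ)) / 2 with hm
  set b : ℕ → ℕ → ℝ := fun n k => (2 / ‖ξ * (d n : ℂ)‖) ^ (k + 2) *
    (G n).closedSawCount (k + 1) / Fintype.card (V n) with hb
  have hβ : ∀ n, 2 / ‖ξ * (d n : ℂ)‖ ≤ 1 / (4 * d n) := fun n => by
    have := hq n
    have := hd0 n
    rw [div_le_div_iff₀ (by linarith) (by linarith)]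
    linarith
  have hb0 : ∀ n k, 0 ≤ b n k := fun n k => by positivity
  -- The error terms are dominated by a geometric series because `2 d / ‖q‖ ≤ 1 / 4`.
  have hb1 : ∀ n k, b n k ≤ (1 / 4) ^ (k + 2) := fun n k => by
    have h1 := (G n).closedSawCount_le (hG n) (k + 1)
    have h2 := hd0 n
    rw [hb, div_le_iff₀ (hN n)]
    calc (2 / ‖ξ * (d n : ℂ)‖) ^ (k + 2) * (G n).closedSawCount (k + 1)
        ≤ (1 / (4 * d n)) ^ (k + 2) * (Fintype.card (V n) * d n ^ (k + 2)) :=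
          mul_le_mul (pow_le_pow_left₀ (by positivity) (hβ n) _) h1 (by positivity) (by positivity)
      _ = _ := by
          rw [div_pow, mul_pow, div_pow]
          field_simp
  -- Each of them tends to zero by the hypothesis on the cycle with `k + 3` nodes.
  have hb2 : ∀ k, Tendsto (fun n => b n k) atTop (𝓝 0) := fun k => by
    refine tendsto_of_tendsto_of_tendsto_of_le_of_le' tendsto_const_nhds
      (hgirth.tendsto_injHomDensity_cycleGraph (k + 3) (by omega))
      (Eventually.of_forall fun n => hb0 n k) ?_
    filter_upwards [hd.eventually_gt_atTop 1] with n hn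
    have h1 : (((G n).closedSawCount (k + 1) : ℕ) : ℝ) ≤ _ :=
      Nat.cast_le.2 ((G n).sum_sawCount_le_card_cycle k)
    have h2 := hd0 n
    have h3 : 0 < d n - 1 := by linarith
    rw [hb, SimpleGraph.injHomDensity, Fintype.card_fin, show k + 3 - 2 = k + 1 by omega,
      mul_assoc, div_le_div_iff₀ (hN n) (by have := hN n; positivity)]
    have h4 : (2 / ‖ξ * (d n : ℂ)‖) ^ (k + 2) * (d n * (d n - 1) ^ (k + 1)) ≤ 1 := by
      calc (2 / ‖ξ * (d n : ℂ)‖) ^ (k + 2) * (d n * (d n - 1) ^ (k + 1))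
          ≤ (1 / d n) ^ (k + 2) * (d n * d n ^ (k + 1)) :=
            mul_le_mul (pow_le_pow_left₀ (by positivity) ((hβ n).trans
              (one_div_le_one_div_of_le h2 (by linarith))) _)
              (mul_le_mul_of_nonneg_left (pow_le_pow_left₀ h3.le (by linarith) _) h2.le)
              (by positivity) (by positivity)
        _ = 1 := by
            rw [← pow_succ', div_pow, one_pow, one_div_mul_cancel (by positivity)]
    calc _ = (2 / ‖ξ * (d n : ℂ)‖) ^ (k + 2) * (d n * (d n - 1) ^ (k + 1)) *
          ((G n).closedSawCount (k + 1) * Fintype.card (V n)) := by ring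
      _ ≤ 1 * (Nat.card {f : SimpleGraph.cycleGraph (k + 3) →g G n // Function.Injective f} *
          Fintype.card (V n)) := by gcongr
      _ = _ := one_mul _
  have hsum : Tendsto (fun n => 4 * ∑' k, b n k) atTop (𝓝 0) := by
    have hs : Summable fun k : ℕ => (1 / 4 : ℝ) ^ (k + 2) :=
      (summable_nat_add_iff 2).2 (summable_geometric_of_lt_one (by norm_num) (by norm_num))
    have := tendsto_tsum_of_dominated_convergence (f := b) (g := fun _ => 0) hs hb2
      (Eventually.of_forall fun n k => by
        rw [Real.norm_of_nonneg (hb0 n k)]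
        exact hb1 n k)
    simpa using this.const_mul 4
  have herr : Tendsto (fun n => (L n - Fintype.card (V n) * Real.log ‖ξ * (d n : ℂ)‖ -
      m n * Real.log ‖1 - 1 / (ξ * (d n : ℂ))‖) / Fintype.card (V n)) atTop (𝓝 0) := by
    refine squeeze_zero_norm (fun n => ?_) hsum
    have h1 := (G n).abs_log_chromaticPolynomial_sub_le (hd1 n) (hq n) (hG n)
    have hs : Summable (b n) := Summable.of_nonneg_of_le (hb0 n) (hb1 n)
      ((summable_nat_add_iff 2).2 (summable_geometric_of_lt_one (by norm_num) (by norm_num)))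
    have h2 := hs.sum_le_tsum (Finset.range (Fintype.card (V n))) fun k _ => hb0 n k
    rw [norm_div, Real.norm_of_nonneg (hN n).le, Real.norm_eq_abs, div_le_iff₀ (hN n)]
    refine h1.trans ?_
    have h3 : ∑ k ∈ Finset.range (Fintype.card (V n)), (2 / ‖ξ * (d n : ℂ)‖) ^ (k + 2) *
        ((G n).closedSawCount (k + 1) : ℝ) =
        (∑ k ∈ Finset.range (Fintype.card (V n)), b n k) * Fintype.card (V n) := by
      rw [Finset.sum_mul]
      refine Finset.sum_congr rfl fun k _ => ?_
      rw [hb, div_mul_cancel₀ _ (hN n).ne']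
    rw [h3, mul_assoc]
    have := hN n
    gcongr
  have hmain : Tendsto (fun n => m n * Real.log ‖1 - 1 / (ξ * (d n : ℂ))‖ / Fintype.card (V n))
      atTop (𝓝 (-t * (1 / (2 * ξ)).re)) := by
    have h1 := (ht.div_const 2).mul (tendsto_mul_log_norm_one_sub_div hd ξ)
    have h2 : t / 2 * -(1 / ξ).re = -t * (1 / (2 * ξ)).re := by
      rw [show 1 / (2 * ξ) = ((1 / 2 : ℝ) : ℂ) * (1 / ξ) by push_cast; field_simp,
        Complex.re_ofReal_mul]
      ring
    rw [h2] at h1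
    refine h1.congr fun n => ?_
    have := hd0 n
    have := hN n
    rw [SimpleGraph.homDensity, SimpleGraph.card_hom_completeGraph_fin_two, hm]
    simp only [Fintype.card_fin]
    push_cast
    field_simp
  have hlog : Tendsto (fun n => L n / Fintype.card (V n) - Real.log ‖ξ * (d n : ℂ)‖) atTop
      (𝓝 (-t * (1 / (2 * ξ)).re)) := by
    have h := herr.add hmain
    rw [zero_add] at h
    refine h.congr fun n => ?_
    have := hN n
    field_simp
    ring
  refine ((Real.continuous_exp.tendsto _).comp hlog).congr fun n => ?_
  have hq0 : 0 < ‖ξ * (d n : ℂ)‖ := by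
    have := hd0 n
    rw [hqn]
    positivity
  rw [Function.comp_apply, Real.exp_sub, Real.exp_log hq0, ← hqn, Real.rpow_def_of_pos (hP n),
    mul_one_div]
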